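/- Let $d\in\{2,3\}$, $N_t\ge 1$, $\Omega_t=[0,1]^{N_t}$, and let $\Omega_x\subset\mathbb R^d$ be either an (open, nonempty) convex polygonal/polyhedral domain or a bounded $C^{1,1}$ domain. Let $\mathcal O=\Omega_x\times\Omega_t$. Let $\mu_0,\dots,\mu_{N_t}\in L^\infty(\Omega_x)$ and put $\mu(x,t)=\mu_0(x)+\sum_{i=1}^{N_t}t_i\mu_i(x)$; assume that there are constants $0<\mu_{\min}\le\mu_{\max}<\infty$ with $\mu_{\min}\le\mu(x,t)\le\mu_{\max}$ for a.e. $(x,t)\in\mathcal O$. Let $H^{-1}(\Omega_x)$ be the dual of $H^1_0(\Omega_x)$, let $f_0,\dots,f_{N_t}\in H^{-1}(\Omega_x)$, and let $f(t)=f_0+\sum_{i=1}^{N_t}t_if_i$. Put $W=L^2(\Omega_t;H^1_0(\Omega_x))$. For a Banach space $X$ and an integer $k\ge0$, $W^{k,\infty}(\Omega_t;X)$ denotes the functions $v:\Omega_t\to X$ whose weak derivatives $\partial_t^\alpha v$, $|\alpha|\le k$, exist and lie in $L^\infty(\Omega_t;X)$, with norm $\|v\|_{W^{k,\infty}(\Omega_t;X)}=\max_{|\alpha|\le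 k}\operatorname{ess\,sup}_{t\in\Omega_t}\|\partial_t^\alpha v(t)\|_X$. (i) There is a unique $u\in W$ with $$\int_{\Omega_t}\!\int_{\Omega_x}\nabla u\cdot\nabla v\,dx\,dt+\int_{\Omega_t}\!\int_{\Omega_x}\mu\,u\,v\,dx\,dt=\int_{\Omega_t}\langle f(t),v(\cdot,t)\rangle_{H^{-1}\times H^1_0}\,dt\qquad\text{for all }v\in W.$$ (ii) For every integer $k\ge0$ the solution $u$ belongs to $W^{k,\infty}(\Omega_t;H^1_0(\Omega_x))$ and $$\|u\|_{W^{k,\infty}(\Omega_t;H^1_0(\Omega_x))}\le C_k\,\|f\|_{W^{k,\infty}(\Omega_t;H^{-1}(\Omega_x))},$$ where $C_k$ is independent of $t$ and of $f$ (it may depend on $k$, $N_t$, $\Omega_x$ and the $\mu_i$). (iii) Let $m\ge2$ be an integer and assume in addition that $\mu_i\in W^{m-2,\infty}(\Omega_x)$ for $i=0,\dots,N_t$ and that the operators $A(t)=-\Delta+\mu(\cdot,t)$ have the uniform elliptic shift property of order $m$: there is a constant $C$ such that for all $t\in\Omega_t$ and all $g\in H^{m-2}(\Omega_x)$ the weak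 solution $w\in H^1_0(\Omega_x)$ of $A(t)w=g$ lies in $H^m(\Omega_x)$ and satisfies $\|w\|_{H^m(\Omega_x)}\le C\|g\|_{H^{m-2}(\Omega_x)}$. Then, for every integer $k\ge0$ such that $f\in W^{k,\infty}(\Omega_t;H^{m-2}(\Omega_x))$, the solution $u$ belongs to $W^{k,\infty}(\Omega_t;H^m(\Omega_x))$ and $$\|u\|_{W^{k,\infty}(\Omega_t;H^m(\Omega_x))}\le C_{k,m}\,\|f\|_{W^{k,\infty}(\Omega_t;H^{m-2}(\Omega_x))},$$ where $C_{k,m}$ is independent of $t$ and of $f$ (it may depend on $k$, $m$, $N_t$, $\Omega_x$, the $\mu_i$ and the shift constant). -/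

import Mathlib

open MeasureTheory Set
open scoped ENNReal NNReal ContDiff RealInnerProductSpace

noncomputable section

namespace ParamElliptic

/-- Euclidean space `ℝⁿ`. -/
abbrev E (n : ℕ) : Type := EuclideanSpace ℝ (Fin n)

/-! ## Multi-indices, test functions and weak derivatives -/

/-- Multi-indices `α ∈ ℕ₀ⁿ` of length `|α| ≤ k`. -/
abbrev MultiIndex (n k : ℕ) : Type := {α : Fin n → ℕ // ∑ i, α i ≤ k}

instance (n k : ℕ) : Finite (MultiIndex n k) := by
  refine Finite.of_injective
    (fun α : MultiIndex n k => fun i : Fin n => (⟨α.1 i, Nat.lt_succ_of_le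
      ((Finset.single_le_sum (fun j _ => Nat.zero_le (α.1 j)) (Finset.mem_univ i)).trans
        α.2)⟩ : Fin (k + 1))) ?_
  intro α β h
  ext i
  simpa using congrArg Fin.val (congrFun h i)

instance (n k : ℕ) : Fintype (MultiIndex n k) := Fintype.ofFinite _

/-- The multi-index `0`. -/
instance (n k : ℕ) : Zero (MultiIndex n k) := ⟨⟨0, by simp⟩⟩

/-- The classical partial derivative `∂_i φ`. -/
def partialDeriv {n : ℕ} (i : Fin n) (φ : E n → ℝ) : E n → ℝ :=
  fun x => fderiv ℝ φ x (EuclideanSpace.single i 1)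

/-- The classical iterated partial derivative
`∂^α φ = ∂_0^{α_0} ∂_1^{α_1} ⋯ ∂_{n-1}^{α_{n-1}} φ` (used for smooth `φ` only). -/
def multiDeriv {n : ℕ} (α : Fin n → ℕ) (φ : E n → ℝ) : E n → ℝ :=
  (List.finRange n).foldr (fun i ψ => (partialDeriv i)^[α i] ψ) φ

/-- Test functions `φ ∈ C_c^∞` whose support lies in the interior of `Ω`. -/
structure IsTest {n : ℕ} (Ω : Set (E n)) (φ : E n → ℝ) : Prop where
  smooth : ContDiff ℝ ∞ φ
  compact : HasCompactSupport φ
  support : tsupport φ ⊆ interior Ω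

/-- `g` is the weak derivative `∂^α u` on (the interior of) `Ω`, for functions with values in a
Banach space `X`:
`∫_Ω ∂^α φ · u = (-1)^{|α|} ∫_Ω φ · g` for all test functions `φ`. -/
structure IsWeakDeriv {n : ℕ} {X : Type*} [NormedAddCommGroup X] [NormedSpace ℝ X]
    (Ω : Set (E n)) (α : Fin n → ℕ) (u g : E n → X) : Prop where
  locInt : LocallyIntegrableOn u (interior Ω)
  locInt_deriv : LocallyIntegrableOn g (interior Ω)
  integral_eq : ∀ φ : E n → ℝ, IsTest Ω φ →
    ∫ x in Ω, multiDeriv α φ x • u x = (-1 : ℝ) ^ (∑ i, α i) • ∫ x in Ω, φ x • g x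

/-- `u ∈ W^{k,∞}(Ω; X)`: for all `|α| ≤ k` the weak derivative `∂^α u` exists and lies in
`L^∞(Ω; X)`. -/
def MemWInf {n : ℕ} {X : Type*} [NormedAddCommGroup X] [NormedSpace ℝ X]
    (Ω : Set (E n)) (k : ℕ) (u : E n → X) : Prop :=
  ∀ α : MultiIndex n k, ∃ g : E n → X,
    IsWeakDeriv Ω α.1 u g ∧ MemLp g ∞ (volume.restrict Ω)

/-- The norm `‖u‖_{W^{k,∞}(Ω; X)} = max_{|α| ≤ k} ess sup_{Ω} ‖∂^α u‖_X`.  Weak derivatives are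
unique up to null sets, so the infimum runs over representatives of the one class `∂^α u`; the
value is `∞` if some `∂^α u` does not exist. -/
def normWInf {n : ℕ} {X : Type*} [NormedAddCommGroup X] [NormedSpace ℝ X]
    (Ω : Set (E n)) (k : ℕ) (u : E n → X) : ℝ≥0∞ :=
  ⨆ α : MultiIndex n k, ⨅ g : {g : E n → X // IsWeakDeriv Ω α.1 u g},
    eLpNorm g.1 ∞ (volume.restrict Ω)

/-! ### Elementary facts, used to see that the spaces below are (closed) subspaces -/

theorem IsTest.partialDeriv {n : ℕ} {Ω : Set (E n)} {φ : E n → ℝ} (h : IsTest Ω φ) (i : Fin n) :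
    IsTest Ω (partialDeriv i φ) where
  smooth := (h.smooth.fderiv_right (m := ∞) (by simp)).clm_apply contDiff_const
  compact := h.compact.fderiv_apply ℝ _
  support := (tsupport_fderiv_apply_subset ℝ _).trans h.support

theorem IsTest.multiDeriv {n : ℕ} {Ω : Set (E n)} {φ : E n → ℝ} (h : IsTest Ω φ)
    (α : Fin n → ℕ) : IsTest Ω (multiDeriv α φ) := by
  unfold ParamElliptic.multiDeriv
  induction List.finRange n with
  | nil => simpa using h
  | cons i l ih =>
    simp only [List.foldr_cons]
    generalize α i = j
    induction j with
    | zero => simpa using ih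
    | succ j ihj =>
      rw [Function.iterate_succ_apply']
      exact ihj.partialDeriv i

theorem IsTest.integrableOn_smul {n : ℕ} {X : Type*} [NormedAddCommGroup X] [NormedSpace ℝ X]
    {Ω : Set (E n)} {φ : E n → ℝ} (h : IsTest Ω φ) {u : E n → X}
    (hu : LocallyIntegrableOn u (interior Ω)) :
    IntegrableOn (fun x => φ x • u x) Ω := by
  have h1 : IntegrableOn u (tsupport φ) := hu.integrableOn_compact_subset h.support h.compact
  have h2 : IntegrableOn (fun x => φ x • u x) (tsupport φ) :=
    h1.continuousOn_smul h.smooth.continuous.continuousOn h.compact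
  refine Integrable.integrableOn ((integrableOn_iff_integrable_of_support_subset ?_).1 h2)
  intro x hx
  refine subset_tsupport φ ?_
  rw [Function.mem_support] at hx ⊢
  exact fun h0 => hx (by simp [h0])

theorem IsTest.memLp {n : ℕ} {Ω : Set (E n)} {φ : E n → ℝ} (h : IsTest Ω φ) :
    MemLp φ 2 (volume.restrict Ω) :=
  (h.smooth.continuous.memLp_of_hasCompactSupport h.compact).restrict Ω

/-! ## Function spaces on the spatial domain -/

/-- `L²(Ω)`. -/
abbrev L2 {d : ℕ} (Ω : Set (E d)) : Type := Lp ℝ 2 (volume.restrict Ω)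

/-- `L²(Ω; ℝᵈ)`. -/
abbrev L2Vec {d : ℕ} (Ω : Set (E d)) : Type := Lp (E d) 2 (volume.restrict Ω)

/-- The pairs `(φ, ∇φ)` with `φ ∈ C_c^∞(Ω)`, in the Hilbert space `L²(Ω) × L²(Ω; ℝᵈ)` with norm
`(‖v‖² + ‖∇v‖²)^{1/2}`. -/
def testGraph {d : ℕ} (Ω : Set (E d)) : Submodule ℝ (WithLp 2 (L2 Ω × L2Vec Ω)) where
  carrier := {p | ∃ φ : E d → ℝ, IsTest Ω φ ∧
    p.fst =ᵐ[volume.restrict Ω] φ ∧ p.snd =ᵐ[volume.restrict Ω] gradient φ}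
  zero_mem' := by
    refine ⟨fun _ => 0, ⟨contDiff_const, HasCompactSupport.zero, ?_⟩, ?_, ?_⟩
    · have : tsupport (fun _ : E d => (0 : ℝ)) = ∅ := tsupport_eq_empty_iff.2 rfl
      simp [this]
    · exact Lp.coeFn_zero _ _ _
    · filter_upwards [Lp.coeFn_zero (E d) 2 (volume.restrict Ω)] with x hx
      simpa [gradient] using hx
  add_mem' := by
    rintro p q ⟨φ, hφ, h1, h2⟩ ⟨ψ, hψ, h3, h4⟩
    refine ⟨φ + ψ, ⟨hφ.smooth.add hψ.smooth, hφ.compact.add hψ.compact,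
      (tsupport_add φ ψ).trans (union_subset hφ.support hψ.support)⟩, ?_, ?_⟩
    · filter_upwards [h1, h3, Lp.coeFn_add p.fst q.fst] with x a b c
      rw [WithLp.add_fst, c]
      simp [a, b]
    · filter_upwards [h2, h4, Lp.coeFn_add p.snd q.snd] with x a b c
      rw [WithLp.add_snd, c]
      have hd1 : DifferentiableAt ℝ φ x := hφ.smooth.differentiable (by simp) x
      have hd2 : DifferentiableAt ℝ ψ x := hψ.smooth.differentiable (by simp) x
      simp only [Pi.add_apply, a, b, gradient]
      rw [fderiv_add hd1 hd2, map_add]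
  smul_mem' := by
    rintro c p ⟨φ, hφ, h1, h2⟩
    refine ⟨c • φ, ⟨contDiff_const.smul hφ.smooth, hφ.compact.smul_left,
      (tsupport_smul_subset_right (fun _ => c) φ).trans hφ.support⟩, ?_, ?_⟩
    · filter_upwards [h1, Lp.coeFn_smul c p.fst] with x a b
      rw [WithLp.smul_fst, b]
      simp [a]
    · filter_upwards [h2, Lp.coeFn_smul c p.snd] with x a b
      rw [WithLp.smul_snd, b]
      have hd : DifferentiableAt ℝ φ x := hφ.smooth.differentiable (by simp) x
      simp only [Pi.smul_apply, a, gradient]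
      rw [fderiv_const_smul hd, map_smul]

/-- `H¹₀(Ω)`: the closure of `C_c^∞(Ω)` in the `H¹`-norm; an element is recorded together with its
weak gradient. -/
abbrev H10 {d : ℕ} (Ω : Set (E d)) : Type := (testGraph Ω).topologicalClosure

instance {d : ℕ} (Ω : Set (E d)) : CompleteSpace (H10 Ω) :=
  (testGraph Ω).isClosed_topologicalClosure.completeSpace_coe

/-- The embedding `H¹₀(Ω) → L²(Ω)`. -/
def H10.toL2 {d : ℕ} (Ω : Set (E d)) : H10 Ω →L[ℝ] L2 Ω :=
  (WithLp.fstL 2 ℝ (L2 Ω) (L2Vec Ω)).comp (testGraph Ω).topologicalClosure.subtypeL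

/-- The gradient `∇ : H¹₀(Ω) → L²(Ω; ℝᵈ)`. -/
def H10.grad {d : ℕ} (Ω : Set (E d)) : H10 Ω →L[ℝ] L2Vec Ω :=
  (WithLp.sndL 2 ℝ (L2 Ω) (L2Vec Ω)).comp (testGraph Ω).topologicalClosure.subtypeL

/-- `H⁻¹(Ω)`, the dual space of `H¹₀(Ω)` with the dual norm. -/
abbrev HNeg1 {d : ℕ} (Ω : Set (E d)) : Type := StrongDual ℝ (H10 Ω)

/-- The embedding `L²(Ω) → H⁻¹(Ω)`, `g ↦ (v ↦ ∫_Ω g v)`. -/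
def L2.toHNeg1 {d : ℕ} {Ω : Set (E d)} (g : L2 Ω) : HNeg1 Ω :=
  (innerSL ℝ g).comp (H10.toL2 Ω)

theorem L2.locallyIntegrableOn {d : ℕ} {Ω : Set (E d)} (v : L2 Ω) :
    LocallyIntegrableOn v (interior Ω) := by
  have h : LocallyIntegrable v (volume.restrict Ω) :=
    (Lp.memLp v).locallyIntegrable (by norm_num)
  exact (locallyIntegrableOn_of_locallyIntegrable_restrict h).mono_set interior_subset

/-- `H^m(Ω)`: families `(v_α)_{|α| ≤ m}` in `L²(Ω)` such that `v_α` is the weak derivative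
`∂^α v_0`.  The norm is `(∑_{|α| ≤ m} ‖∂^α v_0‖²)^{1/2}`. -/
def sobolevH {d : ℕ} (Ω : Set (E d)) (m : ℕ) :
    Submodule ℝ (PiLp 2 (fun _ : MultiIndex d m => L2 Ω)) where
  carrier := {v | ∀ α : MultiIndex d m, IsWeakDeriv Ω α.1 (v 0) (v α)}
  zero_mem' := by
    intro α
    refine ⟨L2.locallyIntegrableOn _, L2.locallyIntegrableOn _, fun φ _ => ?_⟩
    have key : ∀ ψ : E d → ℝ, ∫ x in Ω, ψ x • (0 : L2 Ω) x = 0 := by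
      intro ψ
      refine integral_eq_zero_of_ae ?_
      filter_upwards [Lp.coeFn_zero ℝ 2 (volume.restrict Ω)] with x hx
      rw [hx]
      exact smul_zero _
    rw [PiLp.zero_apply, PiLp.zero_apply, key, key, smul_zero]
  add_mem' := by
    intro v w hv hw α
    refine ⟨L2.locallyIntegrableOn _, L2.locallyIntegrableOn _, fun φ hφ => ?_⟩
    have key : ∀ (ψ : E d → ℝ), IsTest Ω ψ → ∀ f g : L2 Ω,
        ∫ x in Ω, ψ x • (f + g) x = (∫ x in Ω, ψ x • f x) + ∫ x in Ω, ψ x • g x := by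
      intro ψ hψ f g
      rw [← integral_add (hψ.integrableOn_smul f.locallyIntegrableOn)
        (hψ.integrableOn_smul g.locallyIntegrableOn)]
      refine integral_congr_ae ?_
      filter_upwards [Lp.coeFn_add f g] with x hx
      rw [hx, Pi.add_apply, smul_add]
    rw [PiLp.add_apply, PiLp.add_apply, key _ (hφ.multiDeriv α.1), key _ hφ,
      (hv α).integral_eq φ hφ, (hw α).integral_eq φ hφ, smul_add]
  smul_mem' := by
    intro c v hv α
    refine ⟨L2.locallyIntegrableOn _, L2.locallyIntegrableOn _, fun φ hφ => ?_⟩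
    have key : ∀ (ψ : E d → ℝ) (f : L2 Ω),
        ∫ x in Ω, ψ x • (c • f) x = c • ∫ x in Ω, ψ x • f x := by
      intro ψ f
      rw [← integral_smul]
      refine integral_congr_ae ?_
      filter_upwards [Lp.coeFn_smul c f] with x hx
      rw [hx, Pi.smul_apply, smul_comm]
    rw [PiLp.smul_apply, PiLp.smul_apply, key, key, (hv α).integral_eq φ hφ, smul_comm]

/-- The Hilbert space `H^m(Ω)`. -/
abbrev Hm {d : ℕ} (Ω : Set (E d)) (m : ℕ) : Type := sobolevH Ω m

theorem isClosed_sobolevH {d : ℕ} (Ω : Set (E d)) (m : ℕ) :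
    IsClosed (sobolevH Ω m : Set (PiLp 2 (fun _ : MultiIndex d m => L2 Ω))) := by
  have key : ∀ (ψ : E d → ℝ) (hψ : IsTest Ω ψ) (f : L2 Ω),
      ∫ x in Ω, ψ x • f x = ⟪hψ.memLp.toLp ψ, f⟫ := by
    intro ψ hψ f
    rw [L2.inner_def]
    refine integral_congr_ae ?_
    filter_upwards [hψ.memLp.coeFn_toLp] with x hx
    rw [hx]
    simp [mul_comm]
  have hset : (sobolevH Ω m : Set (PiLp 2 (fun _ : MultiIndex d m => L2 Ω))) =
      ⋂ (α : MultiIndex d m) (φ : E d → ℝ) (hφ : IsTest Ω φ),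
        {v | ⟪(hφ.multiDeriv α.1).memLp.toLp _, v 0⟫ =
          (-1 : ℝ) ^ (∑ i, α.1 i) • ⟪hφ.memLp.toLp φ, v α⟫} := by
    ext v
    simp only [mem_iInter, mem_ofPred_eq]
    constructor
    · intro hv α φ hφ
      rw [← key _ (hφ.multiDeriv α.1), ← key _ hφ]
      exact (hv α).integral_eq φ hφ
    · intro hv α
      refine ⟨L2.locallyIntegrableOn _, L2.locallyIntegrableOn _, fun φ hφ => ?_⟩
      rw [key _ (hφ.multiDeriv α.1), key _ hφ]
      exact hv α φ hφ
  rw [hset]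
  refine isClosed_iInter fun α => isClosed_iInter fun φ => isClosed_iInter fun hφ => ?_
  refine isClosed_eq ?_ ?_
  · exact (innerSL ℝ _).continuous.comp
      (PiLp.continuous_apply 2 (fun _ : MultiIndex d m => L2 Ω) 0)
  · have h : Continuous fun v : PiLp 2 (fun _ : MultiIndex d m => L2 Ω) =>
        ⟪hφ.memLp.toLp φ, v α⟫ :=
      (innerSL ℝ _).continuous.comp (PiLp.continuous_apply 2 (fun _ : MultiIndex d m => L2 Ω) α)
    exact h.const_smul ((-1 : ℝ) ^ (∑ i, α.1 i))

instance {d : ℕ} (Ω : Set (E d)) (m : ℕ) : CompleteSpace (Hm Ω m) :=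
  (isClosed_sobolevH Ω m).completeSpace_coe

/-- The embedding `H^m(Ω) → L²(Ω)`. -/
def Hm.toL2 {d : ℕ} {Ω : Set (E d)} {m : ℕ} (v : Hm Ω m) : L2 Ω := v.1 0

/-! ## The domains -/

/-- The open set `Ω` is a convex polygon (`d = 2`), polyhedron (`d = 3`): the nonempty interior of
the convex hull of finitely many points. -/
def IsConvexPolytopeDomain {d : ℕ} (Ω : Set (E d)) : Prop :=
  Ω.Nonempty ∧ ∃ s : Finset (E d), Ω = interior (convexHull ℝ (s : Set (E d)))

/-- `Ω` is a bounded `C^{1,1}` domain: near each boundary point `Ω` is, for some unit vector `ν`,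
the set `{y | g(y') < ⟪ν, y⟫}`, where `y' = y - ⟪ν, y⟫ ν` is the component of `y` orthogonal to `ν`
and `g` is differentiable with Lipschitz continuous derivative. -/
structure IsC11Domain {d : ℕ} (Ω : Set (E d)) : Prop where
  isOpen : IsOpen Ω
  isConnected : IsConnected Ω
  isBounded : Bornology.IsBounded Ω
  boundary : ∀ x ∈ frontier Ω, ∃ ν : E d, ‖ν‖ = 1 ∧ ∃ g : E d → ℝ,
    ContDiff ℝ 1 g ∧ (∃ K : ℝ≥0, LipschitzWith K (fderiv ℝ g)) ∧
    ∃ V : Set (E d), IsOpen V ∧ x ∈ V ∧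
      ∀ y ∈ V, (y ∈ Ω ↔ g (y - (⟪ν, y⟫ : ℝ) • ν) < ⟪ν, y⟫)

/-- The parameter domain `Ω_t = [0,1]^N`. -/
def paramCube (N : ℕ) : Set (E N) := {t | ∀ i, t i ∈ Icc (0 : ℝ) 1}

/-! ## The parametric problem -/

/-- The affine potential `μ(x,t) = μ₀(x) + ∑ᵢ tᵢ μᵢ(x)`. -/
def potential {d N : ℕ} (μ₀ : E d → ℝ) (μ : Fin N → E d → ℝ) (x : E d) (t : E N) : ℝ :=
  μ₀ x + ∑ i, t i * μ i x

/-- The affine source `f(t) = f₀ + ∑ᵢ tᵢ fᵢ` with values in `H⁻¹(Ω)`. -/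
def source {d N : ℕ} {Ω : Set (E d)} (f₀ : HNeg1 Ω) (f : Fin N → HNeg1 Ω) (t : E N) : HNeg1 Ω :=
  f₀ + ∑ i, t i • f i

/-- `W = L²(Ω_t; H¹₀(Ω))`. -/
abbrev W (N : ℕ) {d : ℕ} (Ω : Set (E d)) : Type := Lp (H10 Ω) 2 (volume.restrict (paramCube N))

/-- `u ∈ W` solves `(∇u, ∇v)_𝒪 + (μ u, v)_𝒪 = ⟨F, v⟩` for all `v ∈ W`, where
`𝒪 = Ω × Ω_t`. -/
def IsWeakSolution {d N : ℕ} {Ω : Set (E d)} (μ : E d → E N → ℝ) (F : E N → HNeg1 Ω)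
    (u : W N Ω) : Prop :=
  ∀ v : W N Ω,
    (∫ t in paramCube N, ∫ x in Ω, (⟪H10.grad Ω (u t) x, H10.grad Ω (v t) x⟫ : ℝ)) +
      (∫ t in paramCube N, ∫ x in Ω, μ x t * H10.toL2 Ω (u t) x * H10.toL2 Ω (v t) x) =
    ∫ t in paramCube N, F t (v t)

/-- `w ∈ H¹₀(Ω)` is the (weak) solution of `-Δw + a w = G` for `G ∈ H⁻¹(Ω)`. -/
def IsEllipticSolution {d : ℕ} {Ω : Set (E d)} (a : E d → ℝ) (G : HNeg1 Ω) (w : H10 Ω) : Prop :=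
  ∀ v : H10 Ω,
    (∫ x in Ω, (⟪H10.grad Ω w x, H10.grad Ω v x⟫ : ℝ)) +
      (∫ x in Ω, a x * H10.toL2 Ω w x * H10.toL2 Ω v x) = G v

/-- The uniform elliptic shift property of order `m` for `A(t) = -Δ + μ(·,t)`, `t ∈ Ω_t`: for all
`g ∈ H^{m-2}(Ω)` a solution `w ∈ H¹₀(Ω)` of `A(t) w = g` is in `H^m(Ω)` with
`‖w‖_{H^m} ≤ C ‖g‖_{H^{m-2}}`, where `C` does not depend on `t`. -/
def UniformShift {d N : ℕ} (Ω : Set (E d)) (μ : E d → E N → ℝ) (m : ℕ) : Prop :=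
  ∃ C : ℝ, ∀ t ∈ paramCube N, ∀ (g : Hm Ω (m - 2)) (w : H10 Ω),
    IsEllipticSolution (fun x => μ x t) (L2.toHNeg1 g.toL2) w →
      ∃ w' : Hm Ω m, w'.toL2 = H10.toL2 Ω w ∧ ‖w'‖ ≤ C * ‖g‖

end ParamElliptic

end

open ParamElliptic

/-!
The form `a(t; w, v) = ∫ ∇w · ∇v + ∫ μ(·, t) w v` is coercive on `H¹₀(Ω)` with constant
`min 1 μmin`, uniformly in `t`: the lower bound for `μ` holds almost everywhere in `(x, t)`, hence
for almost every `x` and *every* `t` of the cube, as `μ` is continuous in `t`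
(`potential_lower_bound`, `paramOp_coercive`). By Lax–Milgram the operator
`A(t) = -Δ + μ(·, t) : H¹₀(Ω) → H⁻¹(Ω)` is bijective for every `t` of the cube. Coercivity on the
product domain gives uniqueness in `W`, so that the weak solution is `u(t) = A(t)⁻¹ f(t)` for
almost every `t` (`IsVarSolution.ae_paramOp_eq`).

The regularity in `t` is a statement about affine families of operators. If `K(t) = K₀ + ∑ᵢ tᵢ Kᵢ`
is invertible on the compact cube, then inversion being a smooth map, `K(t)⁻¹` is the restriction
to the cube of a smooth family `S(t)` (`exists_contDiff_inverse`). For affine data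
`F(t) = y₀ + ∑ᵢ tᵢ yᵢ` the function `S(t) F(t)` is a smooth family of operators applied to the
fixed vector `(y₀, y)`; its derivatives are bounded on the cube by multiples of the norm of that
vector, which in turn is at most `2 ess sup ‖F‖`, because the coefficients are read off from the
values at the corners `0` and `e_i`. This is `exists_normWInf_solution_le`; with `K = A` it is the
regularity in the energy space.

For values in `H^m(Ω)` the same result is applied on `H^{m-2}(Ω)` to
`K(t) = A(t) A(0)⁻¹ = 1 + ∑ᵢ tᵢ μᵢ A(0)⁻¹`. Here `A(0)⁻¹` maps `H^{m-2}(Ω)` to `H^m(Ω)` by the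
shift property and multiplication by `μᵢ ∈ W^{m-2,∞}(Ω)` maps `H^m(Ω)` to `H^{m-2}(Ω)`; both are
bounded by the closed graph theorem. The shift property at `t` makes `K(t)` bijective, and
`u(t) = A(0)⁻¹ K(t)⁻¹ f(t)` (`exists_normWInf_le_of_shift`). That a source with almost all values
in `H^{m-2}(Ω)` has coefficients there follows from the fact that a proper affine subspace of the
parameter space is a null set. The product property `W^{k,∞} · H^k ⊆ H^k` (`MemW.mul`) is the
product rule for weak derivatives, proved by mollifying the bounded factor.

The operators are set up on an abstract Hilbert space `H` with bounded maps `J : H → L²(Ω)` and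
`D : H → L²(Ω; ℝᵈ)` such that `‖w‖² = ‖J w‖² + ‖D w‖²`; only the last part specialises `H` to
`H¹₀(Ω)`, with `J` the embedding and `D` the gradient.
-/

noncomputable section

namespace ParamElliptic

open Filter Topology

/-! ### Partial derivatives of smooth functions -/

theorem contDiff_partialDeriv {n : ℕ} {φ : E n → ℝ} (h : ContDiff ℝ ∞ φ) (i : Fin n) :
    ContDiff ℝ ∞ (partialDeriv i φ) :=
  (h.fderiv_right (m := ∞) (by simp)).clm_apply contDiff_const

theorem partialDeriv_comm {n : ℕ} {φ : E n → ℝ} (h : ContDiff ℝ ∞ φ) (i j : Fin n) :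
    partialDeriv i (partialDeriv j φ) = partialDeriv j (partialDeriv i φ) := by
  have hd : Differentiable ℝ (fderiv ℝ φ) :=
    (h.fderiv_right (m := ∞) (by simp)).differentiable (by simp)
  have key : ∀ (i j : Fin n) (x : E n), partialDeriv i (partialDeriv j φ) x =
      fderiv ℝ (fderiv ℝ φ) x (EuclideanSpace.single i 1) (EuclideanSpace.single j 1) := by
    intro i j x
    unfold partialDeriv
    rw [fderiv_clm_apply (hd x) (differentiableAt_const _)]
    simp
  ext x
  rw [key, key]
  exact (h.contDiffAt.isSymmSndFDerivAt (by
    simpa using ENat.LEInfty.out)) _ _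

theorem contDiff_iterate_partialDeriv {n : ℕ} {φ : E n → ℝ} (h : ContDiff ℝ ∞ φ) (i : Fin n)
    (k : ℕ) : ContDiff ℝ ∞ ((partialDeriv i)^[k] φ) := by
  induction k with
  | zero => simpa using h
  | succ k ih =>
    rw [Function.iterate_succ_apply']
    exact contDiff_partialDeriv ih i

theorem contDiff_foldr_partialDeriv {n : ℕ} {φ : E n → ℝ} (h : ContDiff ℝ ∞ φ) (α : Fin n → ℕ)
    (l : List (Fin n)) :
    ContDiff ℝ ∞ (l.foldr (fun i ψ => (partialDeriv i)^[α i] ψ) φ) := by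
  induction l with
  | nil => simpa using h
  | cons i l ih => exact contDiff_iterate_partialDeriv ih i _

theorem partialDeriv_iterate_comm {n : ℕ} {φ : E n → ℝ} (h : ContDiff ℝ ∞ φ) (i j : Fin n)
    (k : ℕ) :
    partialDeriv i ((partialDeriv j)^[k] φ) = (partialDeriv j)^[k] (partialDeriv i φ) := by
  induction k with
  | zero => rfl
  | succ k ih =>
    rw [Function.iterate_succ_apply', Function.iterate_succ_apply', ← ih,
      partialDeriv_comm (contDiff_iterate_partialDeriv h j k)]

theorem partialDeriv_foldr_comm {n : ℕ} {φ : E n → ℝ} (h : ContDiff ℝ ∞ φ) (α : Fin n → ℕ)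
    (l : List (Fin n)) (i : Fin n) :
    partialDeriv i (l.foldr (fun i ψ => (partialDeriv i)^[α i] ψ) φ) =
      l.foldr (fun i ψ => (partialDeriv i)^[α i] ψ) (partialDeriv i φ) := by
  induction l with
  | nil => rfl
  | cons j l ih =>
    simp only [List.foldr_cons]
    rw [← ih, partialDeriv_iterate_comm (contDiff_foldr_partialDeriv h α l)]

/-- An additional derivative in direction `i` can be applied first, since partial derivatives of
smooth functions commute. -/
theorem foldr_partialDeriv_add_single {n : ℕ} {φ : E n → ℝ} (h : ContDiff ℝ ∞ φ) (α : Fin n → ℕ)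
    (i : Fin n) (l : List (Fin n)) (hl : l.Nodup) :
    l.foldr (fun j ψ => (partialDeriv j)^[(α + Pi.single i 1 : Fin n → ℕ) j] ψ) φ =
      if i ∈ l then l.foldr (fun j ψ => (partialDeriv j)^[α j] ψ) (partialDeriv i φ)
      else l.foldr (fun j ψ => (partialDeriv j)^[α j] ψ) φ := by
  induction l with
  | nil => simp
  | cons j l ih =>
    rw [List.nodup_cons] at hl
    simp only [List.foldr_cons]
    rw [ih hl.2]
    by_cases hij : i = j
    · subst hij
      simp only [hl.1, if_false, List.mem_cons, true_or, if_true, Pi.add_apply, Pi.single_eq_same]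
      rw [Function.iterate_succ_apply, partialDeriv_foldr_comm h]
    · have hji : j ≠ i := fun h => hij h.symm
      by_cases hil : i ∈ l <;> simp [hij, hil, hji]

theorem multiDeriv_add_single {n : ℕ} {φ : E n → ℝ} (h : ContDiff ℝ ∞ φ) (α : Fin n → ℕ)
    (i : Fin n) : multiDeriv (α + Pi.single i 1) φ = multiDeriv α (partialDeriv i φ) := by
  unfold multiDeriv
  rw [foldr_partialDeriv_add_single h α i _ (List.nodup_finRange n)]
  simp

@[simp]
theorem multiDeriv_zero {n : ℕ} (φ : E n → ℝ) : multiDeriv 0 φ = φ := by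
  unfold multiDeriv
  induction List.finRange n with
  | nil => rfl
  | cons i l ih => simp

theorem multiDeriv_single {n : ℕ} {φ : E n → ℝ} (h : ContDiff ℝ ∞ φ) (i : Fin n) :
    multiDeriv (Pi.single i 1) φ = partialDeriv i φ := by
  simpa using multiDeriv_add_single h 0 i

theorem sum_add_single {n : ℕ} (α : Fin n → ℕ) (i : Fin n) :
    ∑ j, (α + Pi.single i 1 : Fin n → ℕ) j = ∑ j, α j + 1 := by
  simp [Finset.sum_add_distrib]

theorem exists_eq_add_single {n k : ℕ} {α : Fin n → ℕ} (h : ∑ i, α i = k + 1) :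
    ∃ (β : Fin n → ℕ) (i : Fin n), α = β + Pi.single i 1 ∧ ∑ j, β j = k := by
  obtain ⟨i, -, hi⟩ : ∃ i ∈ Finset.univ, α i ≠ 0 := by
    by_contra! h0
    rw [Finset.sum_eq_zero h0] at h
    omega
  have e : α = (α - Pi.single i 1) + Pi.single i 1 := by
    ext j
    by_cases hj : j = i
    · subst hj; simp; omega
    · simp [hj]
  refine ⟨α - Pi.single i 1, i, e, ?_⟩
  have := sum_add_single (α - Pi.single i 1) i
  rw [← e] at this
  omega

/-! ### Weak derivatives -/

theorem locallyIntegrableOn_congr_ae {n : ℕ} {X : Type*} [NormedAddCommGroup X] {U : Set (E n)}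
    {u v : E n → X} (h : LocallyIntegrableOn u U) (huv : u =ᵐ[volume.restrict U] v) :
    LocallyIntegrableOn v U := by
  intro x hx
  obtain ⟨s, hs, hi⟩ := h x hx
  refine ⟨s ∩ U, Filter.inter_mem hs self_mem_nhdsWithin, ?_⟩
  refine (hi.mono_set inter_subset_left).congr_fun_ae ?_
  exact ae_mono (Measure.restrict_mono inter_subset_right le_rfl) huv

section WeakDeriv

variable {n : ℕ} {X : Type*} [NormedAddCommGroup X] [NormedSpace ℝ X] {Ω : Set (E n)}

/-- Two locally integrable functions with the same integrals against all test functions agree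
almost everywhere in the interior. -/
theorem ae_eq_of_forall_integral_smul_eq [CompleteSpace X] {u v : E n → X}
    (hu : LocallyIntegrableOn u (interior Ω)) (hv : LocallyIntegrableOn v (interior Ω))
    (h : ∀ φ : E n → ℝ, IsTest Ω φ → ∫ x in Ω, φ x • u x = ∫ x in Ω, φ x • v x) :
    ∀ᵐ x, x ∈ interior Ω → u x = v x := by
  have := isOpen_interior.ae_eq_zero_of_integral_contDiff_smul_eq_zero (μ := volume) (hu.sub hv)
    (fun g g1 g2 g3 => ?_)
  · filter_upwards [this] with x hx hxΩ
    exact sub_eq_zero.1 (hx hxΩ)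
  · have hg : IsTest Ω g := ⟨g1, g2, g3⟩
    have e : ∫ x, g x • (u - v) x = ∫ x in Ω, g x • (u - v) x := by
      refine (setIntegral_eq_integral_of_forall_compl_eq_zero fun x hx => ?_).symm
      have : g x = 0 := image_eq_zero_of_notMem_tsupport
        fun h' => hx (interior_subset (g3 h'))
      simp [this]
    rw [e]
    simp only [Pi.sub_apply, smul_sub]
    rw [integral_sub (hg.integrableOn_smul hu) (hg.integrableOn_smul hv), h g hg, sub_self]

/-- A weak derivative is unique up to a null set. -/
theorem IsWeakDeriv.ae_eq [CompleteSpace X] {α : Fin n → ℕ} {u g₁ g₂ : E n → X}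
    (h₁ : IsWeakDeriv Ω α u g₁) (h₂ : IsWeakDeriv Ω α u g₂) :
    ∀ᵐ x, x ∈ interior Ω → g₁ x = g₂ x := by
  refine ae_eq_of_forall_integral_smul_eq h₁.locInt_deriv h₂.locInt_deriv fun φ hφ => ?_
  have := (h₁.integral_eq φ hφ).symm.trans (h₂.integral_eq φ hφ)
  exact smul_right_injective X (pow_ne_zero _ (by norm_num : (-1 : ℝ) ≠ 0)) this

theorem IsWeakDeriv.zero {u : E n → X} (hu : LocallyIntegrableOn u (interior Ω)) :
    IsWeakDeriv Ω 0 u u :=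
  ⟨hu, hu, fun φ _ => by simp⟩

theorem IsWeakDeriv.congr {α : Fin n → ℕ} {u v g h : E n → X} (H : IsWeakDeriv Ω α u g)
    (huv : u =ᵐ[volume.restrict Ω] v) (hgh : g =ᵐ[volume.restrict Ω] h) :
    IsWeakDeriv Ω α v h where
  locInt := locallyIntegrableOn_congr_ae H.locInt
    (ae_mono (Measure.restrict_mono interior_subset le_rfl) huv)
  locInt_deriv := locallyIntegrableOn_congr_ae H.locInt_deriv
    (ae_mono (Measure.restrict_mono interior_subset le_rfl) hgh)
  integral_eq φ hφ := by
    have e1 : ∫ x in Ω, multiDeriv α φ x • v x = ∫ x in Ω, multiDeriv α φ x • u x :=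
      integral_congr_ae (by filter_upwards [huv] with x hx; rw [hx])
    have e2 : ∫ x in Ω, φ x • h x = ∫ x in Ω, φ x • g x :=
      integral_congr_ae (by filter_upwards [hgh] with x hx; rw [hx])
    rw [e1, e2, H.integral_eq φ hφ]

theorem IsWeakDeriv.add {α : Fin n → ℕ} {u v g h : E n → X} (H : IsWeakDeriv Ω α u g)
    (H' : IsWeakDeriv Ω α v h) : IsWeakDeriv Ω α (u + v) (g + h) where
  locInt := H.locInt.add H'.locInt
  locInt_deriv := H.locInt_deriv.add H'.locInt_deriv
  integral_eq φ hφ := by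
    simp only [Pi.add_apply, smul_add]
    rw [integral_add ((hφ.multiDeriv α).integrableOn_smul H.locInt)
      ((hφ.multiDeriv α).integrableOn_smul H'.locInt),
      integral_add (hφ.integrableOn_smul H.locInt_deriv) (hφ.integrableOn_smul H'.locInt_deriv),
      H.integral_eq φ hφ, H'.integral_eq φ hφ, smul_add]

/-- A weak derivative of order `α` of a weak partial derivative is a weak derivative of order
`α + e_i`. -/
theorem IsWeakDeriv.comp_single {α : Fin n → ℕ} {i : Fin n} {u v w : E n → X}
    (h₁ : IsWeakDeriv Ω (Pi.single i 1) u v) (h₂ : IsWeakDeriv Ω α v w) :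
    IsWeakDeriv Ω (α + Pi.single i 1) u w where
  locInt := h₁.locInt
  locInt_deriv := h₂.locInt_deriv
  integral_eq φ hφ := by
    have e1 := h₁.integral_eq _ (hφ.multiDeriv α)
    rw [multiDeriv_single (hφ.multiDeriv α).smooth] at e1
    have e3 : multiDeriv (α + Pi.single i 1) φ = partialDeriv i (multiDeriv α φ) := by
      rw [multiDeriv_add_single hφ.smooth]
      exact (partialDeriv_foldr_comm hφ.smooth α _ i).symm
    rw [e3, e1, h₂.integral_eq φ hφ, sum_add_single, pow_succ]
    simp

/-- Conversely, a weak derivative of order `α + e_i` is a weak derivative of order `α` of the weak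
partial derivative. -/
theorem IsWeakDeriv.of_add_single {α : Fin n → ℕ} {i : Fin n} {u v w : E n → X}
    (h₁ : IsWeakDeriv Ω (Pi.single i 1) u v) (h₂ : IsWeakDeriv Ω (α + Pi.single i 1) u w) :
    IsWeakDeriv Ω α v w where
  locInt := h₁.locInt_deriv
  locInt_deriv := h₂.locInt_deriv
  integral_eq φ hφ := by
    have e1 := h₁.integral_eq _ (hφ.multiDeriv α)
    rw [multiDeriv_single (hφ.multiDeriv α).smooth] at e1
    have e3 : multiDeriv (α + Pi.single i 1) φ = partialDeriv i (multiDeriv α φ) := by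
      rw [multiDeriv_add_single hφ.smooth]
      exact (partialDeriv_foldr_comm hφ.smooth α _ i).symm
    have e2 := h₂.integral_eq φ hφ
    rw [e3, e1, sum_add_single, pow_succ] at e2
    simpa using e2

end WeakDeriv

/-! ### Smooth functions have weak derivatives of all orders -/

section Smooth

variable {n : ℕ} {V : Type*} [NormedAddCommGroup V] [NormedSpace ℝ V]

theorem integral_partialDeriv_smul {φ : E n → ℝ} (hφ : ContDiff ℝ ∞ φ) (hc : HasCompactSupport φ)
    {u : E n → V} (hu : ContDiff ℝ ∞ u) (i : Fin n) :
    ∫ x, partialDeriv i φ x • u x =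
      -∫ x, φ x • fderiv ℝ u x (EuclideanSpace.single i 1) := by
  have hu' : Continuous fun x => fderiv ℝ u x (EuclideanSpace.single i 1) :=
    ((hu.fderiv_right (m := ∞) (by simp)).clm_apply contDiff_const).continuous
  have hi : ∀ (ψ : E n → ℝ) (w : E n → V), Continuous ψ → HasCompactSupport ψ → Continuous w →
      Integrable (fun x => ψ x • w x) := fun ψ w h1 h2 h3 =>
    (h1.smul h3).integrable_of_hasCompactSupport h2.smul_right
  rw [integral_smul_fderiv_eq_neg_fderiv_smul_of_integrable, neg_neg]
  · rfl
  · exact hi _ _ (contDiff_partialDeriv hφ i).continuous (hc.fderiv_apply ℝ _) hu.continuous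
  · exact hi _ _ hφ.continuous hc hu'
  · exact hi _ _ hφ.continuous hc hu.continuous
  · exact fun x _ => hφ.differentiable (by simp) x
  · exact fun x _ => hu.differentiable (by simp) x

/-- Iterated integration by parts along a list of directions.  The derivative `g` is only claimed to
exist: its partial derivatives are taken in the reverse order. -/
theorem exists_integral_foldr_smul (α : Fin n → ℕ) (l : List (Fin n)) {u : E n → V}
    (hu : ContDiff ℝ ∞ u) :
    ∃ g : E n → V, ContDiff ℝ ∞ g ∧ ∀ φ : E n → ℝ, ContDiff ℝ ∞ φ → HasCompactSupport φ →
      ∫ x, l.foldr (fun i ψ => (partialDeriv i)^[α i] ψ) φ x • u x =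
        (-1 : ℝ) ^ (l.map α).sum • ∫ x, φ x • g x := by
  have hcomp : ∀ (φ : E n → ℝ), ContDiff ℝ ∞ φ → HasCompactSupport φ → ∀ (l : List (Fin n)),
      HasCompactSupport (l.foldr (fun i ψ => (partialDeriv i)^[α i] ψ) φ) := by
    intro φ _ hc l
    induction l with
    | nil => simpa using hc
    | cons i l ih =>
      simp only [List.foldr_cons]
      generalize α i = k
      induction k with
      | zero => simpa using ih
      | succ k ihk =>
        rw [Function.iterate_succ_apply']
        exact ihk.fderiv_apply ℝ _
  induction l generalizing u with
  | nil => exact ⟨u, hu, fun φ _ _ => by simp⟩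
  | cons i l ih =>
    have hk : ∀ (k : ℕ) {u : E n → V}, ContDiff ℝ ∞ u → ∃ g : E n → V, ContDiff ℝ ∞ g ∧
        ∀ φ : E n → ℝ, ContDiff ℝ ∞ φ → HasCompactSupport φ →
          ∫ x, (partialDeriv i)^[k] φ x • u x = (-1 : ℝ) ^ k • ∫ x, φ x • g x := by
      intro k
      induction k with
      | zero => exact fun {u} hu => ⟨u, hu, fun φ _ _ => by simp⟩
      | succ k ihk =>
        intro u hu
        obtain ⟨g, hg, h⟩ := ihk hu
        refine ⟨fun x => fderiv ℝ g x (EuclideanSpace.single i 1),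
          (hg.fderiv_right (m := ∞) (by simp)).clm_apply contDiff_const, fun φ h1 h2 => ?_⟩
        rw [Function.iterate_succ_apply, h _ (contDiff_partialDeriv h1 i) (h2.fderiv_apply ℝ _),
          integral_partialDeriv_smul h1 h2 hg, pow_succ]
        simp
    obtain ⟨g₁, hg₁, H₁⟩ := hk (α i) hu
    obtain ⟨g, hg, H⟩ := ih hg₁
    refine ⟨g, hg, fun φ h1 h2 => ?_⟩
    rw [List.foldr_cons, H₁ _ (contDiff_foldr_partialDeriv h1 α l) (hcomp φ h1 h2 l), H φ h1 h2,
      List.map_cons, List.sum_cons, pow_add, mul_smul]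

/-- Iterated integration by parts. -/
theorem exists_integral_multiDeriv_smul (α : Fin n → ℕ) {u : E n → V} (hu : ContDiff ℝ ∞ u) :
    ∃ g : E n → V, ContDiff ℝ ∞ g ∧ ∀ φ : E n → ℝ, ContDiff ℝ ∞ φ → HasCompactSupport φ →
      ∫ x, multiDeriv α φ x • u x = (-1 : ℝ) ^ (∑ i, α i) • ∫ x, φ x • g x := by
  obtain ⟨g, hg, h⟩ := exists_integral_foldr_smul α (List.finRange n) hu
  refine ⟨g, hg, fun φ h1 h2 => ?_⟩
  have e : ((List.finRange n).map α).sum = ∑ i, α i := by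
    rw [← List.ofFn_eq_map, List.sum_ofFn]
  rw [← e]
  exact h φ h1 h2

end Smooth

/-! ### The product rule for weak derivatives -/

section Mollify

variable {n : ℕ}

theorem exists_bound_of_memLp_top {Ω : Set (E n)} {a : E n → ℝ}
    (ha : MemLp a ∞ (volume.restrict Ω)) :
    ∃ C : ℝ, 0 ≤ C ∧ ∀ᵐ x ∂(volume.restrict Ω), ‖a x‖ ≤ C := by
  refine ⟨(eLpNorm a ∞ (volume.restrict Ω)).toReal, ENNReal.toReal_nonneg, ?_⟩
  filter_upwards [ae_le_eLpNormEssSup (f := a) (μ := volume.restrict Ω)] with x hx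
  have h2 := ENNReal.toReal_mono ha.2.ne (hx.trans_eq eLpNorm_exponent_top.symm)
  simpa using h2

theorem contDiff_mollify (ρ : ContDiffBump (0 : E n)) {b : E n → ℝ} (hb : LocallyIntegrable b) :
    ContDiff ℝ ∞ (fun x => ∫ s, ρ.normed volume (x - s) * b s) := by
  have h := HasCompactSupport.contDiff_convolution_left (n := ⊤) (ContinuousLinearMap.lsmul ℝ ℝ)
    (μ := volume) (ρ.hasCompactSupport_normed (μ := volume)) ρ.contDiff_normed hb
  convert h using 1
  ext x
  rw [convolution_lsmul_swap]
  rfl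

theorem integrable_mollify (ρ : ContDiffBump (0 : E n)) (x : E n) :
    Integrable (fun s => ρ.normed volume (x - s)) volume :=
  (ρ.integrable_normed (μ := volume)).comp_sub_left x

theorem norm_mollify_le (ρ : ContDiffBump (0 : E n)) {b : E n → ℝ} {C : ℝ}
    (hb : ∀ᵐ x, ‖b x‖ ≤ C) (x : E n) :
    ‖∫ s, ρ.normed volume (x - s) * b s‖ ≤ C := by
  have h1 : ‖∫ s, ρ.normed volume (x - s) * b s‖ ≤ ∫ s, ρ.normed volume (x - s) * C := by
    refine norm_integral_le_of_norm_le ((integrable_mollify ρ x).mul_const C) ?_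
    filter_upwards [hb] with s hs
    rw [norm_mul, Real.norm_of_nonneg (ρ.nonneg_normed _)]
    exact mul_le_mul_of_nonneg_left hs (ρ.nonneg_normed _)
  refine h1.trans_eq ?_
  rw [integral_mul_const, integral_sub_left_eq_self (fun s => ρ.normed volume s) volume x,
    ρ.integral_normed, one_mul]

theorem partialDeriv_mollify (ρ : ContDiffBump (0 : E n)) {b : E n → ℝ}
    (hb : LocallyIntegrable b) (i : Fin n) (x : E n) :
    partialDeriv i (fun x => ∫ s, ρ.normed volume (x - s) * b s) x =
      ∫ s, partialDeriv i (ρ.normed volume) (x - s) * b s := by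
  have h := HasCompactSupport.hasFDerivAt_convolution_left (ContinuousLinearMap.lsmul ℝ ℝ)
    (μ := volume) (ρ.hasCompactSupport_normed (μ := volume)) (ρ.contDiff_normed (n := 1)) hb x
  have e : convolution (ρ.normed volume) b (ContinuousLinearMap.lsmul ℝ ℝ) volume =
      fun x => ∫ s, ρ.normed volume (x - s) * b s := by
    ext x
    rw [convolution_lsmul_swap]
    rfl
  rw [e] at h
  unfold partialDeriv
  have hex : ConvolutionExists (fderiv ℝ (ρ.normed volume)) b
      ((ContinuousLinearMap.lsmul ℝ ℝ).precompL (E n)) volume :=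
    HasCompactSupport.convolutionExists_left _
      ((ρ.hasCompactSupport_normed (μ := volume)).fderiv ℝ)
      ((ρ.contDiff_normed (n := 1)).continuous_fderiv (by simp)) hb
  rw [h.fderiv, convolution_eq_swap, ContinuousLinearMap.integral_apply (hex x).integrable_swap]
  rfl

/-- A bounded function with a bounded weak partial derivative is, near a compact set, the bounded
almost everywhere limit of smooth functions whose partial derivatives converge in the same
sense. -/
theorem exists_mollification {Ω : Set (E n)} (hΩ : IsOpen Ω) {i : Fin n} {a a' : E n → ℝ}
    (h : IsWeakDeriv Ω (Pi.single i 1) a a') (ha : MemLp a ∞ (volume.restrict Ω))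
    (ha' : MemLp a' ∞ (volume.restrict Ω)) {K : Set (E n)} (hK : IsCompact K) (hKΩ : K ⊆ Ω) :
    ∃ (A A' : ℕ → E n → ℝ) (C : ℝ), (∀ k, ContDiff ℝ ∞ (A k)) ∧ (∀ k, ContDiff ℝ ∞ (A' k)) ∧
      (∀ k, ∀ x ∈ K, partialDeriv i (A k) x = A' k x) ∧
      (∀ k x, ‖A k x‖ ≤ C) ∧ (∀ k x, ‖A' k x‖ ≤ C) ∧
      (∀ᵐ x ∂(volume.restrict Ω), Tendsto (fun k => A k x) atTop (𝓝 (a x))) ∧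
      (∀ᵐ x ∂(volume.restrict Ω), Tendsto (fun k => A' k x) atTop (𝓝 (a' x))) := by
  obtain ⟨δ, hδ, hδΩ⟩ := hK.exists_cthickening_subset_open hΩ hKΩ
  -- The outer radii at most `δ` keep the kernels centred in `K` supported in `Ω`; the fixed
  -- ratio of the radii is needed for convergence at Lebesgue points.
  let ρ : ℕ → ContDiffBump (0 : E n) := fun k =>
    ⟨δ / (2 * (k + 1)), δ / (k + 1), by positivity, by
      apply div_lt_div_of_pos_left hδ (by positivity); linarith [(Nat.cast_nonneg k : (0 : ℝ) ≤ k)]⟩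
  have hρδ : ∀ k, (ρ k).rOut ≤ δ := fun k => div_le_self hδ.le (by simp)
  have hρ0 : Tendsto (fun k => (ρ k).rOut) atTop (𝓝 0) := by
    simpa [ρ, div_eq_mul_inv] using
      (tendsto_one_div_add_atTop_nhds_zero_nat (𝕜 := ℝ)).const_mul δ
  have hρ2 : ∀ᶠ k in atTop, (ρ k).rOut ≤ 2 * (ρ k).rIn := by
    refine Eventually.of_forall fun k => le_of_eq ?_
    show δ / (k + 1) = 2 * (δ / (2 * (k + 1)))
    field_simp
  have hind : ∀ b : E n → ℝ, MemLp b ∞ (volume.restrict Ω) → LocallyIntegrable (Ω.indicator b) :=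
    fun b hb => ((memLp_indicator_iff_restrict hΩ.measurableSet).2 hb).locallyIntegrable (by simp)
  have hbd : ∀ b : E n → ℝ, MemLp b ∞ (volume.restrict Ω) →
      ∃ C : ℝ, ∀ᵐ x, ‖Ω.indicator b x‖ ≤ C := by
    intro b hb
    obtain ⟨C, hC0, hC⟩ := exists_bound_of_memLp_top hb
    refine ⟨C, ?_⟩
    filter_upwards [(ae_restrict_iff' hΩ.measurableSet).1 hC] with x hx
    by_cases hxΩ : x ∈ Ω
    · simpa [hxΩ] using hx hxΩ
    · simpa [hxΩ] using hC0
  have htend : ∀ b : E n → ℝ, MemLp b ∞ (volume.restrict Ω) →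
      ∀ᵐ x ∂(volume.restrict Ω),
        Tendsto (fun k => ∫ s, (ρ k).normed volume (x - s) * Ω.indicator b s) atTop (𝓝 (b x)) := by
    intro b hb
    rw [ae_restrict_iff' hΩ.measurableSet]
    filter_upwards [ContDiffBump.ae_convolution_tendsto_right_of_locallyIntegrable hρ0 hρ2
      (hind b hb)] with x hx hxΩ
    simp only [convolution_lsmul_swap, smul_eq_mul, indicator_of_mem hxΩ] at hx
    exact hx
  obtain ⟨C₁, hC₁⟩ := hbd a ha
  obtain ⟨C₂, hC₂⟩ := hbd a' ha'
  refine ⟨fun k x => ∫ s, (ρ k).normed volume (x - s) * Ω.indicator a s,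
    fun k x => ∫ s, (ρ k).normed volume (x - s) * Ω.indicator a' s, max C₁ C₂,
    fun k => contDiff_mollify _ (hind a ha), fun k => contDiff_mollify _ (hind a' ha'), ?_,
    fun k x => (norm_mollify_le _ hC₁ x).trans (le_max_left _ _),
    fun k x => (norm_mollify_le _ hC₂ x).trans (le_max_right _ _), htend a ha, htend a' ha'⟩
  intro k x hx
  rw [partialDeriv_mollify _ (hind a ha)]
  -- For `x ∈ K` the kernel `s ↦ ρ (x - s)` is a test function on `Ω`.
  have hsm : ContDiff ℝ ∞ ((ρ k).normed (volume : Measure (E n))) := (ρ k).contDiff_normed (n := ⊤)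
  have htest : IsTest Ω (fun s => (ρ k).normed volume (x - s)) := by
    have hsub : ∀ s, s ∈ tsupport (fun s => (ρ k).normed (volume : Measure (E n)) (x - s)) →
        s ∈ Metric.closedBall x (ρ k).rOut := by
      refine fun s hs => closure_minimal (t := Metric.closedBall x (ρ k).rOut) ?_
        Metric.isClosed_closedBall hs
      intro y hy
      have : x - y ∈ Function.support ((ρ k).normed (volume : Measure (E n))) := hy
      rw [(ρ k).support_normed_eq, mem_ball_zero_iff] at this
      rw [mem_closedBall_iff_norm, norm_sub_rev]
      exact this.le
    refine ⟨hsm.comp (contDiff_const.sub contDiff_id), ?_, ?_⟩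
    · exact (isCompact_closedBall x _).of_isClosed_subset (isClosed_tsupport _) hsub
    · rw [hΩ.interior_eq]
      intro s hs
      refine hδΩ (Metric.mem_cthickening_of_dist_le s x δ K hx ?_)
      exact (Metric.mem_closedBall.1 (hsub s hs)).trans (hρδ k)
  have hder : ∀ s, partialDeriv i (fun s => (ρ k).normed volume (x - s)) s =
      -partialDeriv i ((ρ k).normed volume) (x - s) := by
    intro s
    have := ((hsm.differentiable (by simp)) (x - s)).hasFDerivAt.comp s
      ((hasFDerivAt_id s).const_sub x)
    have h2 : HasFDerivAt (fun s => (ρ k).normed volume (x - s)) _ s := this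
    unfold partialDeriv
    rw [h2.fderiv]
    simp
  have key := h.integral_eq _ htest
  rw [multiDeriv_single htest.smooth] at key
  simp only [hder, smul_eq_mul, neg_mul, integral_neg, Finset.sum_pi_single', Finset.mem_univ,
    if_true, pow_one, one_mul, neg_inj] at key
  have e : ∀ (w b : E n → ℝ), ∫ s, w s * Ω.indicator b s = ∫ s in Ω, w s * b s := by
    intro w b
    rw [← integral_indicator hΩ.measurableSet]
    congr 1
    ext s
    by_cases hs : s ∈ Ω <;> simp [hs]
  show _ = ∫ s, (ρ k).normed volume (x - s) * Ω.indicator a' s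
  rw [e, e]
  simpa using key

/-- The product rule, for one bounded factor with bounded weak derivative and one factor in `Lᵖ`
with weak derivative in `Lᵖ`. -/
theorem IsWeakDeriv.mul {Ω : Set (E n)} (hΩ : IsOpen Ω) {i : Fin n} {a a' v v' : E n → ℝ}
    {p : ℝ≥0∞} (hp : 1 ≤ p)
    (h : IsWeakDeriv Ω (Pi.single i 1) a a') (ha : MemLp a ∞ (volume.restrict Ω))
    (ha' : MemLp a' ∞ (volume.restrict Ω)) (hv : IsWeakDeriv Ω (Pi.single i 1) v v')
    (hvp : MemLp v p (volume.restrict Ω)) (hvp' : MemLp v' p (volume.restrict Ω)) :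
    IsWeakDeriv Ω (Pi.single i 1) (a * v) (a' * v + a * v') := by
  have hloc : ∀ u : E n → ℝ, MemLp u p (volume.restrict Ω) → LocallyIntegrableOn u (interior Ω) :=
    fun u hu => (locallyIntegrableOn_of_locallyIntegrable_restrict
      (hu.locallyIntegrable hp)).mono_set interior_subset
  have l1 : LocallyIntegrableOn (a * v) (interior Ω) := hloc _ (hvp.mul ha)
  have l2 : LocallyIntegrableOn (a' * v) (interior Ω) := hloc _ (hvp.mul ha')
  have l3 : LocallyIntegrableOn (a * v') (interior Ω) := hloc _ (hvp'.mul ha)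
  refine ⟨l1, l2.add l3, fun φ hφ => ?_⟩
  rw [multiDeriv_single hφ.smooth]
  obtain ⟨A, A', C, hA, hA', hAA', hAC, hAC', hlim, hlim'⟩ := exists_mollification hΩ h ha ha'
    hφ.compact (hφ.support.trans interior_subset)
  -- The product rule tested with `φ` is the limit of the definition of `v'` tested with `φ A k`.
  have hk : ∀ k, ∫ x in Ω, (A k x * (partialDeriv i φ x * v x) + A' k x * (φ x * v x) +
      A k x * (φ x * v' x)) = 0 := by
    intro k
    have ht : IsTest Ω (φ * A k) := ⟨hφ.smooth.mul (hA k), hφ.compact.mul_right,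
      (tsupport_mul_subset_left).trans hφ.support⟩
    have e1 : ∀ x, partialDeriv i (φ * A k) x = A k x * partialDeriv i φ x + A' k x * φ x := by
      intro x
      have h1 : partialDeriv i (φ * A k) x =
          φ x * partialDeriv i (A k) x + A k x * partialDeriv i φ x := by
        unfold partialDeriv
        rw [fderiv_mul (hφ.smooth.differentiable (by simp) x)
          ((hA k).differentiable (by simp) x)]
        simp
      rw [h1]
      by_cases hx : x ∈ tsupport φ
      · rw [hAA' k x hx]; ring
      · rw [image_eq_zero_of_notMem_tsupport hx]; ring
    have key := hv.integral_eq _ ht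
    rw [multiDeriv_single ht.smooth] at key
    simp only [Finset.sum_pi_single', Finset.mem_univ, if_true, pow_one, neg_smul, one_smul] at key
    have i1 := (ht.partialDeriv i).integrableOn_smul hv.locInt
    have i2 := ht.integrableOn_smul hv.locInt_deriv
    have key2 := eq_neg_iff_add_eq_zero.1 key
    rw [← integral_add i1 i2] at key2
    rw [← key2]
    refine integral_congr_ae (Eventually.of_forall fun x => ?_)
    simp only [e1, smul_eq_mul, Pi.mul_apply]
    ring
  have j1 : IntegrableOn (fun x => partialDeriv i φ x * v x) Ω :=
    (hφ.partialDeriv i).integrableOn_smul hv.locInt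
  have j2 : IntegrableOn (fun x => φ x * v x) Ω := hφ.integrableOn_smul hv.locInt
  have j3 : IntegrableOn (fun x => φ x * v' x) Ω := hφ.integrableOn_smul hv.locInt_deriv
  have hT : Tendsto (fun k => ∫ x in Ω, (A k x * (partialDeriv i φ x * v x) +
      A' k x * (φ x * v x) + A k x * (φ x * v' x))) atTop
      (𝓝 (∫ x in Ω, (a x * (partialDeriv i φ x * v x) + a' x * (φ x * v x) +
        a x * (φ x * v' x)))) := by
    refine tendsto_integral_of_dominated_convergence
      (fun x => C * ‖partialDeriv i φ x * v x‖ + C * ‖φ x * v x‖ + C * ‖φ x * v' x‖) ?_ ?_ ?_ ?_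
    · intro k
      exact (((hA k).continuous.aestronglyMeasurable.mul j1.1).add
        ((hA' k).continuous.aestronglyMeasurable.mul j2.1)).add
        ((hA k).continuous.aestronglyMeasurable.mul j3.1)
    · exact ((j1.norm.const_mul C).add (j2.norm.const_mul C)).add (j3.norm.const_mul C)
    · refine fun k => Eventually.of_forall fun x => ?_
      refine (norm_add₃_le).trans ?_
      rw [norm_mul (A k x), norm_mul (A' k x), norm_mul (A k x)]
      gcongr
      exacts [hAC k x, hAC' k x, hAC k x]
    · filter_upwards [hlim, hlim'] with x h1 h2
      exact ((h1.mul_const _).add (h2.mul_const _)).add (h1.mul_const _)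
  simp only [hk] at hT
  have h0 := tendsto_nhds_unique hT tendsto_const_nhds
  simp only [Finset.sum_pi_single', Finset.mem_univ, if_true, pow_one, neg_smul, one_smul]
  rw [eq_neg_iff_add_eq_zero, ← integral_add ((hφ.partialDeriv i).integrableOn_smul l1)
    (hφ.integrableOn_smul (l2.add l3)), ← h0]
  refine integral_congr_ae (Eventually.of_forall fun x => ?_)
  simp only [smul_eq_mul, Pi.mul_apply, Pi.add_apply]
  ring

end Mollify

/-! ### Multiplication by a function of class `W^{k,∞}` -/

section MemW

variable {n : ℕ} {Ω : Set (E n)} {p : ℝ≥0∞}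

/-- `u ∈ W^{k,p}(Ω)`: the weak derivatives of order at most `k` exist and lie in `Lᵖ(Ω)`. -/
def MemW (p : ℝ≥0∞) (Ω : Set (E n)) (k : ℕ) (u : E n → ℝ) : Prop :=
  ∀ α : MultiIndex n k, ∃ g : E n → ℝ,
    IsWeakDeriv Ω α.1 u g ∧ MemLp g p (volume.restrict Ω)

theorem ae_restrict_of_ae_interior {X : Type*} {u v : E n → X} (hΩ : IsOpen Ω)
    (h : ∀ᵐ x, x ∈ interior Ω → u x = v x) : u =ᵐ[volume.restrict Ω] v := by
  rw [hΩ.interior_eq] at h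
  exact (ae_restrict_iff' hΩ.measurableSet).2 h

theorem MemW.mono {k l : ℕ} (h : l ≤ k) {u : E n → ℝ} (hu : MemW p Ω k u) : MemW p Ω l u :=
  fun α => hu ⟨α.1, α.2.trans h⟩

theorem MemW.memLp (hΩ : IsOpen Ω) {k : ℕ} {u : E n → ℝ} (hu : MemW p Ω k u) :
    MemLp u p (volume.restrict Ω) := by
  obtain ⟨g, hg, hgp⟩ := hu 0
  exact (memLp_congr_ae (ae_restrict_of_ae_interior hΩ
    ((IsWeakDeriv.zero hg.locInt).ae_eq hg))).2 hgp

theorem MemW.exists_partial {k : ℕ} {u : E n → ℝ} (hu : MemW p Ω (k + 1) u) (i : Fin n) :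
    ∃ g : E n → ℝ, IsWeakDeriv Ω (Pi.single i 1) u g ∧ MemW p Ω k g := by
  obtain ⟨g, hg, -⟩ := hu ⟨Pi.single i 1, by simp⟩
  refine ⟨g, hg, fun α => ?_⟩
  obtain ⟨h, hh, hhp⟩ := hu ⟨α.1 + Pi.single i 1, by
    rw [sum_add_single]; exact Nat.succ_le_succ α.2⟩
  exact ⟨h, hg.of_add_single hh, hhp⟩

theorem MemW.zero (hp : 1 ≤ p) {u : E n → ℝ} (hu : MemLp u p (volume.restrict Ω)) :
    MemW p Ω 0 u := by
  intro α
  have hα : α.1 = 0 := by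
    have := α.2
    simp only [Nat.le_zero, Finset.sum_eq_zero_iff, Finset.mem_univ, true_imp_iff] at this
    exact funext this
  rw [hα]
  refine ⟨u, IsWeakDeriv.zero ?_, hu⟩
  exact (locallyIntegrableOn_of_locallyIntegrable_restrict
    (hu.locallyIntegrable hp)).mono_set interior_subset

/-- A function in `Lᵖ` with weak partial derivatives in `W^{k,p}` lies in `W^{k+1,p}`. -/
theorem MemW.of_partial (hp : 1 ≤ p) {k : ℕ} {u : E n → ℝ} (hu : MemLp u p (volume.restrict Ω))
    (h : ∀ i, ∃ g : E n → ℝ, IsWeakDeriv Ω (Pi.single i 1) u g ∧ MemW p Ω k g) :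
    MemW p Ω (k + 1) u := by
  rintro ⟨α, hα⟩
  obtain ⟨l, hl⟩ : ∃ l, ∑ i, α i = l := ⟨_, rfl⟩
  cases l with
  | zero =>
    exact MemW.zero hp hu ⟨α, hl.le⟩
  | succ l =>
    obtain ⟨β, i, rfl, hβ⟩ := exists_eq_add_single hl
    obtain ⟨g, hg, hgk⟩ := h i
    obtain ⟨w, hw, hwp⟩ := hgk ⟨β, by omega⟩
    exact ⟨w, hg.comp_single hw, hwp⟩

theorem MemW.add {k : ℕ} {u v : E n → ℝ} (hu : MemW p Ω k u) (hv : MemW p Ω k v) :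
    MemW p Ω k (u + v) := by
  intro α
  obtain ⟨g, hg, hgp⟩ := hu α
  obtain ⟨h, hh, hhp⟩ := hv α
  exact ⟨g + h, hg.add hh, hgp.add hhp⟩

/-- `W^{k,∞} · W^{k,p} ⊆ W^{k,p}`. -/
theorem MemW.mul (hΩ : IsOpen Ω) (hp : 1 ≤ p) {k : ℕ} {a v : E n → ℝ} (ha : MemW ∞ Ω k a)
    (hv : MemW p Ω k v) : MemW p Ω k (a * v) := by
  induction k generalizing a v with
  | zero => exact MemW.zero hp ((hv.memLp hΩ).mul (ha.memLp hΩ))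
  | succ k ih =>
    refine MemW.of_partial hp ((hv.memLp hΩ).mul (ha.memLp hΩ)) fun i => ?_
    obtain ⟨a', ha', hak⟩ := ha.exists_partial i
    obtain ⟨v', hv', hvk⟩ := hv.exists_partial i
    exact ⟨_, ha'.mul hΩ hp (ha.memLp hΩ) (hak.memLp hΩ) hv' (hv.memLp hΩ) (hvk.memLp hΩ),
      (ih hak (hv.mono (Nat.le_succ k))).add (ih (ha.mono (Nat.le_succ k)) hvk)⟩

end MemW

/-! ### The parameter cube -/

section Cube

variable {N : ℕ}

theorem paramCube_eq_preimage :
    paramCube N = (EuclideanSpace.equiv (Fin N) ℝ) ⁻¹' (univ.pi fun _ => Icc (0 : ℝ) 1) := by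
  ext t
  simp only [paramCube, mem_preimage, mem_univ_pi]
  rfl

theorem isCompact_paramCube : IsCompact (paramCube N) := by
  rw [paramCube_eq_preimage]
  exact (EuclideanSpace.equiv (Fin N) ℝ).toHomeomorph.isCompact_preimage.2
    (isCompact_univ_pi fun _ => isCompact_Icc)

theorem convex_paramCube : Convex ℝ (paramCube N) := by
  rw [paramCube_eq_preimage]
  exact (convex_pi fun i _ => convex_Icc (0 : ℝ) 1).linear_preimage
    (EuclideanSpace.equiv (Fin N) ℝ).toLinearEquiv.toLinearMap

theorem zero_mem_paramCube : (0 : E N) ∈ paramCube N := by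
  intro i
  simp

theorem single_mem_paramCube (i : Fin N) : (EuclideanSpace.single i 1 : E N) ∈ paramCube N := by
  intro j
  by_cases h : j = i <;> simp [h]

theorem interior_paramCube_nonempty : (interior (paramCube N)).Nonempty := by
  have hO : IsOpen ((EuclideanSpace.equiv (Fin N) ℝ) ⁻¹' (univ.pi fun _ => Ioo (0 : ℝ) 1)) :=
    (isOpen_set_pi finite_univ fun _ _ => isOpen_Ioo).preimage
      (EuclideanSpace.equiv (Fin N) ℝ).continuous
  refine ⟨(EuclideanSpace.equiv (Fin N) ℝ).symm fun _ => 1 / 2, interior_maximal ?_ hO ?_⟩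
  · rw [paramCube_eq_preimage]
    exact preimage_mono (pi_mono fun _ _ => Ioo_subset_Icc_self)
  · simp only [mem_preimage, ContinuousLinearEquiv.apply_symm_apply, mem_univ_pi]
    intro i
    constructor <;> norm_num

theorem ae_restrict_paramCube_of_interior {p : E N → Prop}
    (h : ∀ᵐ t, t ∈ interior (paramCube N) → p t) : ∀ᵐ t ∂(volume.restrict (paramCube N)), p t := by
  rw [ae_restrict_iff' isCompact_paramCube.measurableSet]
  have hfr : ∀ᵐ t : E N, t ∉ frontier (paramCube N) :=
    measure_eq_zero_iff_ae_notMem.1 (convex_paramCube.addHaar_frontier volume)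
  filter_upwards [h, hfr] with t h1 h2 ht
  refine h1 ?_
  by_contra h3
  exact h2 ⟨subset_closure ht, h3⟩

/-- A closed condition that holds almost everywhere in the cube holds everywhere in the cube. -/
theorem forall_mem_paramCube_of_ae {C : Set (E N)} (hC : IsClosed C)
    (h : ∀ᵐ t ∂(volume.restrict (paramCube N)), t ∈ C) : paramCube N ⊆ C := by
  have h1 : interior (paramCube N) ⊆ C := by
    have ho : IsOpen (interior (paramCube N) \ C) := isOpen_interior.sdiff hC
    have hm : volume (interior (paramCube N) \ C) = 0 := by
      rw [ae_restrict_iff' isCompact_paramCube.measurableSet] at h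
      refine measure_mono_null ?_ (ae_iff.1 h)
      intro t ht hc
      exact ht.2 (hc (interior_subset ht.1))
    have he := (ho.measure_eq_zero_iff volume).1 hm
    exact sdiff_eq_empty.1 he
  calc paramCube N ⊆ closure (paramCube N) := subset_closure
    _ = closure (interior (paramCube N)) :=
      (convex_paramCube.closure_interior_eq_closure_of_nonempty_interior
        interior_paramCube_nonempty).symm
    _ ⊆ C := closure_minimal h1 hC

end Cube

/-! ### Affine families -/

section Affine

variable {N : ℕ} {Z : Type*} [NormedAddCommGroup Z] [NormedSpace ℝ Z]

/-- The affine family `t ↦ z₀ + ∑ᵢ tᵢ zᵢ`. -/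
def affineFamily (z₀ : Z) (z : Fin N → Z) (t : E N) : Z := z₀ + ∑ i, t i • z i

theorem contDiff_affineFamily (z₀ : Z) (z : Fin N → Z) :
    ContDiff ℝ ∞ (affineFamily z₀ z) := by
  unfold affineFamily
  refine contDiff_const.add (ContDiff.sum fun i _ => ContDiff.smul ?_ contDiff_const)
  exact (EuclideanSpace.proj (𝕜 := ℝ) i : E N →L[ℝ] ℝ).contDiff

@[simp]
theorem affineFamily_zero (z₀ : Z) (z : Fin N → Z) : affineFamily z₀ z 0 = z₀ := by
  simp [affineFamily]

theorem affineFamily_add (a z₀ : Z) (z : Fin N → Z) (t : E N) :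
    affineFamily (a + z₀) z t = a + affineFamily z₀ z t :=
  add_assoc _ _ _

theorem affineFamily_single (z₀ : Z) (z : Fin N → Z) (i : Fin N) :
    affineFamily z₀ z (EuclideanSpace.single i 1) = z₀ + z i := by
  simp [affineFamily, PiLp.single_apply]

theorem affineFamily_apply {Y : Type*} [NormedAddCommGroup Y] [NormedSpace ℝ Y] (K₀ : Y →L[ℝ] Z)
    (K : Fin N → Y →L[ℝ] Z) (t : E N) (y : Y) :
    (affineFamily K₀ K t : Y →L[ℝ] Z) y = affineFamily (K₀ y) (fun i => K i y) t := by
  simp [affineFamily]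

theorem map_affineFamily {Y : Type*} [NormedAddCommGroup Y] [NormedSpace ℝ Y] (L : Z →L[ℝ] Y)
    (z₀ : Z) (z : Fin N → Z) (t : E N) :
    L (affineFamily z₀ z t) = affineFamily (L z₀) (fun i => L (z i)) t := by
  simp [affineFamily]

/-- The coefficients of an affine family are bounded by its essential supremum over the cube: they
are combinations of its values at the corners `0` and `e_i`. -/
theorem enorm_coeff_affineFamily_le (z₀ : Z) (z : Fin N → Z) :
    ‖(z₀, z)‖ₑ ≤ 2 * eLpNorm (affineFamily z₀ z) ∞ (volume.restrict (paramCube N)) := by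
  set M := eLpNorm (affineFamily z₀ z) ∞ (volume.restrict (paramCube N)) with hM
  have hsub : paramCube N ⊆ {t | ‖affineFamily z₀ z t‖ₑ ≤ M} := by
    refine forall_mem_paramCube_of_ae ?_ ?_
    · exact isClosed_le (contDiff_affineFamily z₀ z).continuous.enorm continuous_const
    · rw [hM, eLpNorm_exponent_top]
      exact ae_le_eLpNormEssSup
  have h0 : ‖z₀‖ₑ ≤ M := by simpa using hsub zero_mem_paramCube
  have h2 : M ≤ 2 * M := le_mul_of_one_le_left zero_le (by norm_num)
  have hi : ∀ i, ‖z i‖ₑ ≤ 2 * M := by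
    intro i
    have h1 : ‖z₀ + z i‖ₑ ≤ M := by
      simpa [affineFamily_single] using hsub (single_mem_paramCube i)
    calc ‖z i‖ₑ = ‖(z₀ + z i) - z₀‖ₑ := by rw [add_sub_cancel_left]
      _ ≤ ‖z₀ + z i‖ₑ + ‖z₀‖ₑ := enorm_sub_le
      _ ≤ 2 * M := by rw [two_mul]; exact add_le_add h1 h0
  by_cases hMt : 2 * M = ⊤
  · rw [hMt]; exact le_top
  obtain ⟨m, hm⟩ := WithTop.ne_top_iff_exists.1 hMt
  change (m : ℝ≥0∞) = _ at hm
  rw [← hm] at h2 hi ⊢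
  rw [enorm_le_coe, Prod.nnnorm_def, max_le_iff, pi_nnnorm_le_iff]
  exact ⟨enorm_le_coe.1 (h0.trans h2), fun i => enorm_le_coe.1 (hi i)⟩

end Affine

/-! ### Solutions of affine parametric equations depend smoothly on the parameter -/

theorem IsTest.setIntegral_eq {N : ℕ} {X : Type*} [NormedAddCommGroup X] [NormedSpace ℝ X]
    {Ω : Set (E N)} {φ : E N → ℝ} (hφ : IsTest Ω φ) (u : E N → X) :
    ∫ x in Ω, φ x • u x = ∫ x, φ x • u x :=
  setIntegral_eq_integral_of_forall_compl_eq_zero fun x hx => by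
    have : φ x = 0 := image_eq_zero_of_notMem_tsupport
      fun h' => hx (interior_subset (hφ.support h'))
    simp [this]

/-- A smooth family of operators applied to a fixed vector lies in `W^{k,∞}` of the cube, with norm
at most a constant times the norm of the vector. -/
theorem exists_normWInf_apply_le {N : ℕ} {X Z : Type*} [NormedAddCommGroup X] [NormedSpace ℝ X]
    [NormedAddCommGroup Z] [NormedSpace ℝ Z] (k : ℕ)
    {T : E N → Z →L[ℝ] X} (hT : ContDiff ℝ ∞ T) :
    ∃ C : ℝ≥0, ∀ (z : Z) (U : E N → X),
      U =ᵐ[volume.restrict (paramCube N)] (fun t => T t z) →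
        MemWInf (paramCube N) k U ∧ normWInf (paramCube N) k U ≤ C * ‖z‖ₑ := by
  choose g hg hint using fun α : MultiIndex N k => exists_integral_multiDeriv_smul α.1 hT
  have hbd : ∀ α, ∃ C : ℝ≥0, ∀ t ∈ paramCube N, ‖g α t‖₊ ≤ C := by
    intro α
    obtain ⟨C, hC⟩ := (isCompact_paramCube (N := N)).bddAbove_image
      (f := fun t => ‖g α t‖₊) (hg α).continuous.nnnorm.continuousOn
    exact ⟨C, fun t ht => hC ⟨t, ht, rfl⟩⟩
  choose C hC using hbd
  have hcont : ∀ (S : E N → Z →L[ℝ] X), ContDiff ℝ ∞ S → ∀ z, Continuous fun t => S t z :=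
    fun S hS z => hS.continuous.clm_apply continuous_const
  have hw : ∀ (z : Z) (U : E N → X), U =ᵐ[volume.restrict (paramCube N)] (fun t => T t z) →
      ∀ α : MultiIndex N k, IsWeakDeriv (paramCube N) α.1 U (fun t => g α t z) := by
    intro z U hU α
    refine IsWeakDeriv.congr (u := fun t => T t z) (g := fun t => g α t z) ?_ hU.symm
      (Filter.EventuallyEq.refl _ _)
    refine ⟨(hcont T hT z).locallyIntegrable.locallyIntegrableOn _,
      (hcont _ (hg α) z).locallyIntegrable.locallyIntegrableOn _, fun φ hφ => ?_⟩
    rw [(hφ.multiDeriv α.1).setIntegral_eq, hφ.setIntegral_eq]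
    have happ : ∀ (ψ : E N → ℝ), IsTest (paramCube N) ψ → ∀ S : E N → Z →L[ℝ] X,
        ContDiff ℝ ∞ S → ∫ t, ψ t • S t z = (∫ t, ψ t • S t) z := by
      intro ψ hψ S hS
      rw [ContinuousLinearMap.integral_apply]
      · rfl
      · exact (hψ.smooth.continuous.smul hS.continuous).integrable_of_hasCompactSupport
          hψ.compact.smul_right
    rw [happ _ (hφ.multiDeriv α.1) T hT, happ _ hφ _ (hg α), hint α φ hφ.smooth hφ.compact]
    rfl
  have hle : ∀ (z : Z) (α : MultiIndex N k),
      eLpNorm (fun t => g α t z) ∞ (volume.restrict (paramCube N)) ≤ C α * ‖z‖ₑ := by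
    intro z α
    rw [eLpNorm_exponent_top]
    have : (C α : ℝ≥0∞) * ‖z‖ₑ = ((C α * ‖z‖₊ : ℝ≥0) : ℝ≥0∞) := by
      rw [ENNReal.coe_mul]; rfl
    rw [this]
    refine eLpNormEssSup_le_of_ae_enorm_bound ?_
    filter_upwards [ae_restrict_mem isCompact_paramCube.measurableSet] with t ht
    rw [enorm_le_coe]
    have h1 : ‖g α t z‖₊ ≤ ‖g α t‖₊ * ‖z‖₊ := (g α t).le_opNNNorm z
    exact h1.trans (mul_le_mul' (hC α t ht) le_rfl)
  refine ⟨∑ α, C α, fun z U hU => ⟨fun α => ⟨_, hw z U hU α, ?_, ?_⟩, ?_⟩⟩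
  · have hc : Continuous fun t => g α t z := hcont _ (hg α) z
    exact hc.aestronglyMeasurable
  · exact (hle z α).trans_lt (ENNReal.mul_lt_top ENNReal.coe_lt_top enorm_lt_top)
  · refine iSup_le fun α => ?_
    have hα : C α ≤ ∑ β, C β :=
      Finset.single_le_sum (f := C) (fun _ _ => zero_le) (Finset.mem_univ α)
    have h1 : (C α : ℝ≥0∞) * ‖z‖ₑ ≤ ((∑ β, C β : ℝ≥0) : ℝ≥0∞) * ‖z‖ₑ :=
      mul_le_mul' (ENNReal.coe_le_coe.2 hα) le_rfl
    exact (iInf_le (fun g : {g : E N → X // IsWeakDeriv (paramCube N) α.1 U g} =>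
      eLpNorm g.1 ⊤ (volume.restrict (paramCube N))) ⟨_, hw z U hU α⟩).trans ((hle z α).trans h1)

section Abstract

variable {N : ℕ} {X Y X' : Type*} [NormedAddCommGroup X] [NormedSpace ℝ X] [CompleteSpace X]
  [NormedAddCommGroup Y] [NormedSpace ℝ Y] [CompleteSpace Y]
  [NormedAddCommGroup X'] [NormedSpace ℝ X']

/-- The inverse of an affine family of operators that is invertible on the cube is, on the cube,
the restriction of a smooth family. -/
theorem exists_contDiff_inverse (K₀ : X →L[ℝ] Y) (K : Fin N → X →L[ℝ] Y)
    (hK : ∀ t ∈ paramCube N, Function.Bijective (affineFamily K₀ K t : X →L[ℝ] Y)) :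
    ∃ S : E N → Y →L[ℝ] X, ContDiff ℝ ∞ S ∧
      ∀ t ∈ paramCube N, (∀ x, S t ((affineFamily K₀ K t : X →L[ℝ] Y) x) = x) ∧
        ∀ y, (affineFamily K₀ K t : X →L[ℝ] Y) (S t y) = y := by
  set A : E N → X →L[ℝ] Y := affineFamily K₀ K with hA
  have hAs : ContDiff ℝ ∞ A := contDiff_affineFamily K₀ K
  -- The family is invertible on an open neighbourhood `U` of the cube; a cutoff `χ` that is `1`
  -- near the cube and `0` near the complement of `U` makes the inverse smooth on the whole space.
  set U : Set (E N) := A ⁻¹' range ((↑) : (X ≃L[ℝ] Y) → X →L[ℝ] Y) with hU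
  have hUo : IsOpen U := ContinuousLinearEquiv.isOpen.preimage hAs.continuous
  have hinv : ∀ t ∈ U, (A t).IsInvertible := fun t ht => ht
  have hcube : paramCube N ⊆ U := by
    intro t ht
    refine ⟨ContinuousLinearEquiv.ofBijective (A t) ?_ ?_, ?_⟩
    · exact LinearMap.ker_eq_bot.2 (hK t ht).1
    · exact LinearMap.range_eq_top.2 (hK t ht).2
    · ext x; rfl
  obtain ⟨χ, hχ0, hχ1, -⟩ := exists_contMDiffMap_zero_one_nhds_of_isClosed (n := ⊤)
    (modelWithCornersSelf ℝ (E N)) hUo.isClosed_compl isCompact_paramCube.isClosed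
    (disjoint_compl_left_iff_subset.2 hcube)
  have hχ : ContDiff ℝ ∞ χ := χ.contMDiff.contDiff
  refine ⟨fun t => χ t • (A t).inverse, ?_, fun t ht => ?_⟩
  · rw [contDiff_iff_contDiffAt]
    intro t
    by_cases ht : t ∈ U
    · exact hχ.contDiffAt.smul
        ((hinv t ht).contDiffAt_map_inverse.comp t hAs.contDiffAt)
    · have h0 : ∀ᶠ s in 𝓝 t, χ s = 0 := (eventually_nhdsSet_iff_forall.1 hχ0) t ht
      refine (contDiffAt_const (c := 0)).congr_of_eventuallyEq ?_
      filter_upwards [h0] with s hs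
      simp [hs]
  · have h1 : χ t = 1 := hχ1.self_of_nhdsSet t ht
    have hi := hinv t (hcube ht)
    simp [h1, hi.inverse_apply_self, hi.self_apply_inverse]

/-- The essential supremum of `G` is the part of order zero of its `W^{k,∞}` norm. -/
theorem eLpNorm_le_normWInf (k : ℕ) (G : E N → X) :
    eLpNorm G ∞ (volume.restrict (paramCube N)) ≤ normWInf (paramCube N) k G := by
  refine le_trans ?_ (le_iSup _ (0 : MultiIndex N k))
  refine le_iInf fun g => ?_
  have hg : IsWeakDeriv (paramCube N) 0 G g.1 := g.2
  refine (eLpNorm_congr_ae ?_).le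
  exact ae_restrict_paramCube_of_interior ((IsWeakDeriv.zero hg.locInt).ae_eq hg)

/-- Parametric regularity: let the affine family `K(t) = K₀ + ∑ᵢ tᵢ Kᵢ` be invertible on the cube,
and let `P` be a bounded operator.  Then `t ↦ P (K(t)⁻¹ F(t))`, for `F` affine, is of class
`W^{k,∞}` for every `k`, with a norm bounded by that of `F`.  The data enter
through any `G` equal to `F` almost everywhere, the solution through any `U` that takes the
right value at almost every parameter. -/
theorem exists_normWInf_solution_le (K₀ : X →L[ℝ] Y) (K : Fin N → X →L[ℝ] Y)
    (hK : ∀ t ∈ paramCube N, Function.Bijective (affineFamily K₀ K t : X →L[ℝ] Y))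
    (P : X →L[ℝ] X') (k : ℕ) :
    ∃ C : ℝ≥0, ∀ (y₀ : Y) (y : Fin N → Y) (G : E N → Y) (U : E N → X'),
      G =ᵐ[volume.restrict (paramCube N)] affineFamily y₀ y →
      (∀ᵐ t ∂(volume.restrict (paramCube N)), ∀ x,
        (affineFamily K₀ K t : X →L[ℝ] Y) x = affineFamily y₀ y t → U t = P x) →
        MemWInf (paramCube N) k U ∧
          normWInf (paramCube N) k U ≤ C * normWInf (paramCube N) k G := by
  obtain ⟨S, hS, hinv⟩ := exists_contDiff_inverse K₀ K hK
  -- The affine data are treated as a single vector `(y₀, y)`, to which a smooth family of operators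
  -- is applied.
  let ev : E N → (Y × (Fin N → Y)) →L[ℝ] Y := affineFamily
    (ContinuousLinearMap.fst ℝ Y (Fin N → Y))
    (fun i => (ContinuousLinearMap.proj i).comp (ContinuousLinearMap.snd ℝ Y (Fin N → Y)))
  have hev : ContDiff ℝ ∞ ev := contDiff_affineFamily _ _
  have hev' : ∀ t (z : Y × (Fin N → Y)), ev t z = affineFamily z.1 z.2 t := fun t z => by
    simp only [ev]
    rw [affineFamily_apply]
    rfl
  obtain ⟨C, hC⟩ := exists_normWInf_apply_le k
    (T := fun t => P.comp ((S t).comp (ev t)))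
    (contDiff_const.clm_comp (hS.clm_comp hev))
  refine ⟨C * 2, fun y₀ y G U hG hU => ?_⟩
  obtain ⟨h1, h2⟩ := hC (y₀, y) U (by
    filter_upwards [hU, ae_restrict_mem isCompact_paramCube.measurableSet] with t h ht
    refine h (S t (ev t (y₀, y))) ?_
    rw [(hinv t ht).2, hev'])
  refine ⟨h1, h2.trans ?_⟩
  have h3 := enorm_coeff_affineFamily_le y₀ y
  rw [← eLpNorm_congr_ae hG] at h3
  calc (C : ℝ≥0∞) * ‖(y₀, y)‖ₑ ≤ C * (2 * normWInf (paramCube N) k G) := by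
        gcongr
        exact h3.trans (by gcongr; exact eLpNorm_le_normWInf k G)
    _ = ((C * 2 : ℝ≥0) : ℝ≥0∞) * normWInf (paramCube N) k G := by
        push_cast
        rw [mul_assoc]

end Abstract

/-! ### The elliptic operators -/

/-- The operator `G → H'` of the bilinear form `(w, v) ↦ ⟪S w, T v⟫` on `G × H`. -/
def formOp {G H Z : Type*} [NormedAddCommGroup G] [NormedSpace ℝ G] [NormedAddCommGroup H]
    [NormedSpace ℝ H] [NormedAddCommGroup Z] [InnerProductSpace ℝ Z]
    (S : G →L[ℝ] Z) (T : H →L[ℝ] Z) : G →L[ℝ] StrongDual ℝ H :=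
  LinearMap.mkContinuous₂ (LinearMap.mk₂ ℝ (fun w v => (⟪S w, T v⟫ : ℝ))
    (fun _ _ _ => by simp [inner_add_left]) (fun _ _ _ => by simp [inner_smul_left])
    (fun _ _ _ => by simp [inner_add_right]) (fun _ _ _ => by simp [inner_smul_right]))
    (‖S‖ * ‖T‖) (fun w v => by
      calc ‖(⟪S w, T v⟫ : ℝ)‖ ≤ ‖S w‖ * ‖T v‖ := norm_inner_le_norm _ _
        _ ≤ (‖S‖ * ‖w‖) * (‖T‖ * ‖v‖) := by
          gcongr
          exacts [S.le_opNorm w, T.le_opNorm v]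
        _ = ‖S‖ * ‖T‖ * ‖w‖ * ‖v‖ := by ring)

@[simp]
theorem formOp_apply {G H Z : Type*} [NormedAddCommGroup G] [NormedSpace ℝ G]
    [NormedAddCommGroup H] [NormedSpace ℝ H] [NormedAddCommGroup Z] [InnerProductSpace ℝ Z]
    (S : G →L[ℝ] Z) (T : H →L[ℝ] Z) (w : G) (v : H) : formOp S T w v = ⟪S w, T v⟫ := rfl

/-- Lax–Milgram: a coercive operator `H → H'` is bijective. -/
theorem bijective_of_coercive {H : Type*} [NormedAddCommGroup H] [InnerProductSpace ℝ H]
    [CompleteSpace H] (B : H →L[ℝ] StrongDual ℝ H) {c : ℝ} (hc : 0 < c)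
    (h : ∀ w, c * ‖w‖ ^ 2 ≤ B w w) : Function.Bijective B := by
  have hB : IsCoercive B := ⟨c, hc, fun w => by rw [mul_assoc, ← sq]; exact h w⟩
  constructor
  · rw [injective_iff_map_eq_zero]
    intro w hw
    have := h w
    rw [hw, zero_apply] at this
    have h2 : ‖w‖ ^ 2 ≤ 0 := nonpos_of_mul_nonpos_right this hc
    simpa using le_antisymm h2 (sq_nonneg _)
  · intro G
    refine ⟨hB.continuousLinearEquivOfBilin.symm ((InnerProductSpace.toDual ℝ H).symm G), ?_⟩
    ext v
    rw [← hB.continuousLinearEquivOfBilin_apply, ContinuousLinearEquiv.apply_symm_apply,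
      InnerProductSpace.toDual_symm_apply]

section Elliptic

variable {d N : ℕ} {Ω : Set (E d)}

/-- Multiplication by an `L^∞` function, as an operator on `L²(Ω)`. -/
def mulL2 {a : E d → ℝ} (ha : MemLp a ∞ (volume.restrict Ω)) : L2 Ω →L[ℝ] L2 Ω :=
  (ContinuousLinearMap.mul ℝ ℝ).holderL (volume.restrict Ω) ∞ 2 2 (ha.toLp a)

theorem coeFn_mulL2 {a : E d → ℝ} (ha : MemLp a ∞ (volume.restrict Ω)) (v : L2 Ω) :
    mulL2 ha v =ᵐ[volume.restrict Ω] fun x => a x * v x := by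
  have h := (ContinuousLinearMap.mul ℝ ℝ).coeFn_holder (r := 2) (ha.toLp a) v
  filter_upwards [h, ha.coeFn_toLp] with x h1 h2
  calc mulL2 ha v x = (ContinuousLinearMap.mul ℝ ℝ).holder 2 (ha.toLp a) v x := rfl
    _ = a x * v x := by rw [h1, h2]; rfl

variable {H : Type*} [NormedAddCommGroup H] [InnerProductSpace ℝ H]

/-- The map `g ↦ (v ↦ ⟪g, J v⟫)` from `L²(Ω)` to `H'` dual to `J : H → L²(Ω)`. -/
def dualEmb (J : H →L[ℝ] L2 Ω) : L2 Ω →L[ℝ] StrongDual ℝ H :=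
  formOp (ContinuousLinearMap.id ℝ (L2 Ω)) J

/-- The operator `w ↦ a w` from `H` to `H'`. -/
def potOp (J : H →L[ℝ] L2 Ω) {a : E d → ℝ} (ha : MemLp a ∞ (volume.restrict Ω)) :
    H →L[ℝ] StrongDual ℝ H :=
  formOp ((mulL2 ha).comp J) J

/-- The weak Laplacian `-Δ : H → H'` belonging to the gradient `D`. -/
def negLaplacian (D : H →L[ℝ] L2Vec Ω) : H →L[ℝ] StrongDual ℝ H := formOp D D

variable {J : H →L[ℝ] L2 Ω} {D : H →L[ℝ] L2Vec Ω}

theorem negLaplacian_apply (w v : H) :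
    negLaplacian D w v = ∫ x in Ω, (⟪D w x, D v x⟫ : ℝ) := by
  rw [negLaplacian, formOp_apply, L2.inner_def]

theorem integrable_mul_mul {a : E d → ℝ} (ha : MemLp a ∞ (volume.restrict Ω)) (w v : L2 Ω) :
    IntegrableOn (fun x => a x * w x * v x) Ω := by
  refine (L2.integrable_inner (𝕜 := ℝ) (mulL2 ha w) v).congr ?_
  filter_upwards [coeFn_mulL2 ha w] with x hx
  rw [hx]
  simp [mul_comm]

theorem potOp_apply {a : E d → ℝ} (ha : MemLp a ∞ (volume.restrict Ω)) (w v : H) :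
    potOp J ha w v = ∫ x in Ω, a x * J w x * J v x := by
  rw [potOp, formOp_apply, L2.inner_def]
  refine integral_congr_ae ?_
  filter_upwards [coeFn_mulL2 ha (J w)] with x hx
  rw [ContinuousLinearMap.comp_apply, hx]
  simp [mul_comm]

variable {μ₀ : E d → ℝ} {μ : Fin N → E d → ℝ} (hμ₀ : MemLp μ₀ ∞ (volume.restrict Ω))
  (hμ : ∀ i, MemLp (μ i) ∞ (volume.restrict Ω))

variable (J) in
/-- The operator of multiplication by `μ(·, t)` from `H` to `H'`. -/
def paramPotOp (t : E N) : H →L[ℝ] StrongDual ℝ H :=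
  affineFamily (potOp J hμ₀) (fun i => potOp J (hμ i)) t

variable (J D) in
/-- The operator `A(t) = -Δ + μ(·, t)` from `H` to `H'`, an affine family in `t`. -/
def paramOp (t : E N) : H →L[ℝ] StrongDual ℝ H :=
  affineFamily (negLaplacian D + potOp J hμ₀) (fun i => potOp J (hμ i)) t

theorem paramOp_eq (t : E N) : paramOp J D hμ₀ hμ t = negLaplacian D + paramPotOp J hμ₀ hμ t :=
  affineFamily_add _ _ _ _

theorem paramPotOp_apply_apply (t : E N) (w v : H) :
    paramPotOp J hμ₀ hμ t w v = potOp J hμ₀ w v + ∑ i, t i * potOp J (hμ i) w v := by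
  simp [paramPotOp, affineFamily]

theorem integrable_potential_mul_mul (hμ₀ : MemLp μ₀ ∞ (volume.restrict Ω))
    (hμ : ∀ i, MemLp (μ i) ∞ (volume.restrict Ω)) (t : E N) (w v : L2 Ω) :
    IntegrableOn (fun x => potential μ₀ μ x t * w x * v x) Ω := by
  have h : IntegrableOn (fun x => μ₀ x * w x * v x + ∑ i, t i * (μ i x * w x * v x)) Ω :=
    (integrable_mul_mul hμ₀ w v).add
      (integrable_finsetSum _ fun i _ => (integrable_mul_mul (hμ i) w v).const_mul (t i))
  refine h.congr (Eventually.of_forall fun x => ?_)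
  simp only [potential, add_mul, Finset.sum_mul]
  simp only [mul_assoc]

theorem paramPotOp_apply (t : E N) (w v : H) :
    paramPotOp J hμ₀ hμ t w v =
      ∫ x in Ω, potential μ₀ μ x t * J w x * J v x := by
  rw [paramPotOp_apply_apply]
  simp only [potOp_apply]
  simp_rw [← integral_const_mul]
  rw [← integral_finsetSum _ fun i _ =>
    (integrable_mul_mul (hμ i) (J w) (J v)).const_mul (t i),
    ← integral_add (integrable_mul_mul hμ₀ _ _) (integrable_finsetSum _ fun i _ =>
    (integrable_mul_mul (hμ i) (J w) (J v)).const_mul (t i))]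
  refine integral_congr_ae (Eventually.of_forall fun x => ?_)
  simp only [potential, add_mul, Finset.sum_mul]
  simp only [mul_assoc]

theorem paramOp_eq_iff (t : E N) (G : StrongDual ℝ H) (w : H) :
    paramOp J D hμ₀ hμ t w = G ↔ ∀ v, (∫ x in Ω, (⟪D w x, D v x⟫ : ℝ)) +
      (∫ x in Ω, potential μ₀ μ x t * J w x * J v x) = G v := by
  rw [paramOp_eq]
  constructor
  · rintro rfl v
    rw [add_apply, add_apply, negLaplacian_apply,
      paramPotOp_apply]
  · intro h
    ext v
    rw [← h v, add_apply, add_apply, negLaplacian_apply,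
      paramPotOp_apply]

/-- The lower bound for the potential holds for every parameter in the cube, since the potential
is continuous in the parameter. -/
theorem potential_lower_bound {μmin : ℝ}
    (hbd : ∀ᵐ p ∂((volume.restrict Ω).prod (volume.restrict (paramCube N))),
      μmin ≤ potential μ₀ μ p.1 p.2) :
    ∀ᵐ x ∂(volume.restrict Ω), ∀ t ∈ paramCube N, μmin ≤ potential μ₀ μ x t := by
  filter_upwards [Measure.ae_ae_of_ae_prod hbd] with x hx
  refine forall_mem_paramCube_of_ae (C := {t | μmin ≤ potential μ₀ μ x t}) ?_ hx
  exact isClosed_le continuous_const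
    (contDiff_affineFamily (μ₀ x) (fun i => μ i x)).continuous

theorem paramOp_coercive (hJD : ∀ w, ‖w‖ ^ 2 = ‖J w‖ ^ 2 + ‖D w‖ ^ 2)
    {μmin : ℝ}
    (hbd : ∀ᵐ p ∂((volume.restrict Ω).prod (volume.restrict (paramCube N))),
      μmin ≤ potential μ₀ μ p.1 p.2) {t : E N} (ht : t ∈ paramCube N) (w : H) :
    min 1 μmin * ‖w‖ ^ 2 ≤ paramOp J D hμ₀ hμ t w w := by
  have h1 : negLaplacian D w w = ‖D w‖ ^ 2 := by
    rw [negLaplacian, formOp_apply, real_inner_self_eq_norm_sq]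
  have h2 : μmin * ‖J w‖ ^ 2 ≤ paramPotOp J hμ₀ hμ t w w := by
    rw [paramPotOp_apply, ← real_inner_self_eq_norm_sq, L2.inner_def, ← integral_const_mul]
    refine integral_mono_ae ((L2.integrable_inner (𝕜 := ℝ) _ _).const_mul _)
      (integrable_potential_mul_mul hμ₀ hμ t _ _) ?_
    filter_upwards [potential_lower_bound hbd] with x hx
    simp only [real_inner_self_eq_norm_sq, Real.norm_eq_abs, sq_abs]
    nlinarith [mul_le_mul_of_nonneg_right (hx t ht) (sq_nonneg (J w x))]
  rw [paramOp_eq, add_apply, add_apply, h1,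
    hJD, mul_add, add_comm]
  refine add_le_add ?_ (le_trans ?_ h2)
  · exact mul_le_of_le_one_left (sq_nonneg _) (min_le_left _ _)
  · exact mul_le_mul_of_nonneg_right (min_le_right _ _) (sq_nonneg _)

theorem paramOp_bijective [CompleteSpace H]
    (hJD : ∀ w, ‖w‖ ^ 2 = ‖J w‖ ^ 2 + ‖D w‖ ^ 2) {μmin : ℝ} (hμmin : 0 < μmin)
    (hbd : ∀ᵐ p ∂((volume.restrict Ω).prod (volume.restrict (paramCube N))),
      μmin ≤ potential μ₀ μ p.1 p.2) {t : E N} (ht : t ∈ paramCube N) :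
    Function.Bijective (paramOp J D hμ₀ hμ t) :=
  bijective_of_coercive _ (lt_min one_pos hμmin) (paramOp_coercive hμ₀ hμ hJD hbd ht)

/-! ### The weak formulation on the product domain -/

variable (J D) in
/-- `u ∈ L²(Ω_t; H)` solves `(D u, D v) + (μ J u, J v) = ⟨F, v⟩` for all `v ∈ L²(Ω_t; H)`. -/
def IsVarSolution (μ : E d → E N → ℝ) (F : E N → StrongDual ℝ H)
    (u : Lp H 2 (volume.restrict (paramCube N))) : Prop :=
  ∀ v : Lp H 2 (volume.restrict (paramCube N)),
    (∫ t in paramCube N, ∫ x in Ω, (⟪D (u t) x, D (v t) x⟫ : ℝ)) +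
      (∫ t in paramCube N, ∫ x in Ω, μ x t * J (u t) x * J (v t) x) =
    ∫ t in paramCube N, F t (v t)

theorem integrable_bilin {N : ℕ} (B : H →L[ℝ] StrongDual ℝ H)
    (u v : Lp H 2 (volume.restrict (paramCube N))) :
    IntegrableOn (fun t => B (u t) (v t)) (paramCube N) :=
  memLp_one_iff_integrable.1 (B.memLp_of_bilin 1 (Lp.memLp u) (Lp.memLp v))

theorem integrable_paramPotOp (u v : Lp H 2 (volume.restrict (paramCube N))) :
    IntegrableOn (fun t => paramPotOp J hμ₀ hμ t (u t) (v t)) (paramCube N) := by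
  simp only [paramPotOp_apply_apply]
  refine (integrable_bilin _ u v).add (integrable_finsetSum _ fun i _ => ?_)
  refine (integrable_bilin (potOp J (hμ i)) u v).bdd_mul (c := 1) ?_ ?_
  · exact (EuclideanSpace.proj (𝕜 := ℝ) i : E N →L[ℝ] ℝ).continuous.aestronglyMeasurable
  · filter_upwards [ae_restrict_mem isCompact_paramCube.measurableSet] with t ht
    rw [Real.norm_of_nonneg (ht i).1]
    exact (ht i).2

theorem integrable_paramOp (u v : Lp H 2 (volume.restrict (paramCube N))) :
    IntegrableOn (fun t => paramOp J D hμ₀ hμ t (u t) (v t)) (paramCube N) := by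
  refine ((integrable_bilin (negLaplacian D) u v).add
    (integrable_paramPotOp (J := J) hμ₀ hμ u v)).congr (Eventually.of_forall fun t => ?_)
  simp [paramOp_eq]

theorem isVarSolution_iff (F : E N → StrongDual ℝ H) (u : Lp H 2 (volume.restrict (paramCube N))) :
    IsVarSolution J D (potential μ₀ μ) F u ↔ ∀ v : Lp H 2 (volume.restrict (paramCube N)),
      ∫ t in paramCube N, paramOp J D hμ₀ hμ t (u t) (v t) = ∫ t in paramCube N, F t (v t) := by
  have h : ∀ v : Lp H 2 (volume.restrict (paramCube N)),
      ∫ t in paramCube N, paramOp J D hμ₀ hμ t (u t) (v t) =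
      (∫ t in paramCube N, ∫ x in Ω, (⟪D (u t) x, D (v t) x⟫ : ℝ)) +
      (∫ t in paramCube N, ∫ x in Ω,
        potential μ₀ μ x t * J (u t) x * J (v t) x) := by
    intro v
    simp_rw [← negLaplacian_apply, ← paramPotOp_apply hμ₀ hμ]
    rw [← integral_add (integrable_bilin (negLaplacian D) u v)
      (integrable_paramPotOp (J := J) hμ₀ hμ u v)]
    simp [paramOp_eq]
  simp only [IsVarSolution, h]

theorem isVarSolution_of_ae {F : E N → StrongDual ℝ H} {u : Lp H 2 (volume.restrict (paramCube N))}
    (h : ∀ᵐ t ∂(volume.restrict (paramCube N)), paramOp J D hμ₀ hμ t (u t) = F t) :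
    IsVarSolution J D (potential μ₀ μ) F u := by
  rw [isVarSolution_iff hμ₀ hμ]
  intro v
  refine integral_congr_ae ?_
  filter_upwards [h] with t ht
  rw [ht]

/-- Weak solutions are unique: the form is coercive on the product domain. -/
theorem IsVarSolution.unique (hJD : ∀ w, ‖w‖ ^ 2 = ‖J w‖ ^ 2 + ‖D w‖ ^ 2)
    {μmin : ℝ} (hμ₀ : MemLp μ₀ ∞ (volume.restrict Ω))
    (hμ : ∀ i, MemLp (μ i) ∞ (volume.restrict Ω)) (hμmin : 0 < μmin)
    (hbd : ∀ᵐ p ∂((volume.restrict Ω).prod (volume.restrict (paramCube N))),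
      μmin ≤ potential μ₀ μ p.1 p.2) {F : E N → StrongDual ℝ H}
    {u u' : Lp H 2 (volume.restrict (paramCube N))}
    (h : IsVarSolution J D (potential μ₀ μ) F u) (h' : IsVarSolution J D (potential μ₀ μ) F u') :
    u = u' := by
  rw [isVarSolution_iff hμ₀ hμ] at h h'
  have hc : 0 < min 1 μmin := lt_min one_pos hμmin
  have e : ∫ t in paramCube N, paramOp J D hμ₀ hμ t ((u - u') t) ((u - u') t) = 0 := by
    have h1 := sub_eq_zero.2 ((h (u - u')).trans (h' (u - u')).symm)
    rw [← integral_sub (integrable_paramOp hμ₀ hμ _ _) (integrable_paramOp hμ₀ hμ _ _)] at h1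
    rw [← h1]
    refine integral_congr_ae ?_
    filter_upwards [Lp.coeFn_sub u u'] with t ht
    nth_rewrite 1 [ht]
    simp
  have h2 : min 1 μmin * ⟪u - u', u - u'⟫ ≤ 0 := by
    rw [← e, L2.inner_def, ← integral_const_mul]
    refine integral_mono_ae ((L2.integrable_inner (𝕜 := ℝ) _ _).const_mul _)
      (integrable_paramOp hμ₀ hμ _ _) ?_
    filter_upwards [ae_restrict_mem isCompact_paramCube.measurableSet] with t ht
    rw [real_inner_self_eq_norm_sq]
    exact paramOp_coercive hμ₀ hμ hJD hbd ht _
  rw [real_inner_self_eq_norm_sq] at h2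
  have h3 : ‖u - u'‖ ^ 2 ≤ 0 := nonpos_of_mul_nonpos_right h2 hc
  have h4 : ‖u - u'‖ = 0 := by simpa using le_antisymm h3 (sq_nonneg _)
  exact sub_eq_zero.1 (norm_eq_zero.1 h4)

/-- The elliptic problems at the single parameters have a common solution in `L²(Ω_t; H)`. -/
theorem exists_ae_paramOp_eq [CompleteSpace H]
    (hJD : ∀ w, ‖w‖ ^ 2 = ‖J w‖ ^ 2 + ‖D w‖ ^ 2) {μmin : ℝ}
    (hμmin : 0 < μmin)
    (hbd : ∀ᵐ p ∂((volume.restrict Ω).prod (volume.restrict (paramCube N))),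
      μmin ≤ potential μ₀ μ p.1 p.2) (f₀ : StrongDual ℝ H) (f : Fin N → StrongDual ℝ H) :
    ∃ u : Lp H 2 (volume.restrict (paramCube N)), ∀ᵐ t ∂(volume.restrict (paramCube N)),
      paramOp J D hμ₀ hμ t (u t) = affineFamily f₀ f t := by
  obtain ⟨S, hS, hinv⟩ := exists_contDiff_inverse (N := N) (negLaplacian D + potOp J hμ₀)
    (fun i => potOp J (hμ i)) (fun t ht => paramOp_bijective hμ₀ hμ hJD hμmin hbd ht)
  have hcont : Continuous fun t => S t (affineFamily f₀ f t) :=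
    hS.continuous.clm_apply (contDiff_affineFamily f₀ f).continuous
  have hmem : MemLp (fun t => S t (affineFamily f₀ f t)) 2 (volume.restrict (paramCube N)) := by
    have hfin : IsFiniteMeasure (volume.restrict (paramCube N)) :=
      ⟨by simpa using isCompact_paramCube.measure_lt_top⟩
    obtain ⟨C, hC⟩ := (isCompact_paramCube (N := N)).exists_bound_of_continuousOn
      hcont.continuousOn
    refine MemLp.of_bound hcont.aestronglyMeasurable C ?_
    filter_upwards [ae_restrict_mem isCompact_paramCube.measurableSet] with t ht
    exact hC t ht
  refine ⟨hmem.toLp _, ?_⟩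
  filter_upwards [hmem.coeFn_toLp, ae_restrict_mem isCompact_paramCube.measurableSet] with t h1 ht
  rw [h1]
  exact (hinv t ht).2 _

/-- The weak solution solves the elliptic problem at almost every parameter. -/
theorem IsVarSolution.ae_paramOp_eq [CompleteSpace H]
    (hJD : ∀ w, ‖w‖ ^ 2 = ‖J w‖ ^ 2 + ‖D w‖ ^ 2) {μmin : ℝ}
    (hμ₀ : MemLp μ₀ ∞ (volume.restrict Ω))
    (hμ : ∀ i, MemLp (μ i) ∞ (volume.restrict Ω)) (hμmin : 0 < μmin)
    (hbd : ∀ᵐ p ∂((volume.restrict Ω).prod (volume.restrict (paramCube N))),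
      μmin ≤ potential μ₀ μ p.1 p.2) {f₀ : StrongDual ℝ H} {f : Fin N → StrongDual ℝ H}
    {u : Lp H 2 (volume.restrict (paramCube N))}
    (h : IsVarSolution J D (potential μ₀ μ) (affineFamily f₀ f) u) :
    ∀ᵐ t ∂(volume.restrict (paramCube N)), paramOp J D hμ₀ hμ t (u t) = affineFamily f₀ f t := by
  obtain ⟨u', hu'⟩ := exists_ae_paramOp_eq hμ₀ hμ hJD hμmin hbd f₀ f
  rwa [h.unique hJD hμ₀ hμ hμmin hbd (isVarSolution_of_ae hμ₀ hμ hu')]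

end Elliptic

/-! ### Higher spatial regularity -/

/-- A bounded operator whose values lie in the range of an injective bounded operator factors
boundedly through it, by the closed graph theorem. -/
theorem exists_clm_comp_eq {X Y Z : Type*} [NormedAddCommGroup X] [NormedSpace ℝ X]
    [CompleteSpace X] [NormedAddCommGroup Y] [NormedSpace ℝ Y] [CompleteSpace Y]
    [NormedAddCommGroup Z] [NormedSpace ℝ Z] (j : Y →L[ℝ] Z) (hj : Function.Injective j)
    (B : X →L[ℝ] Z) (h : ∀ x, ∃ y, j y = B x) : ∃ L : X →L[ℝ] Y, ∀ x, j (L x) = B x := by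
  choose g hg using h
  let L : X →ₗ[ℝ] Y :=
    { toFun := g
      map_add' := fun x y => hj (by simp [hg])
      map_smul' := fun c x => hj (by simp [hg]) }
  have hL : Continuous L := by
    refine L.continuous_of_seq_closed_graph fun u x y hu hLu => hj ?_
    have h1 : Tendsto (fun n => j (L (u n))) atTop (𝓝 (j y)) := (j.continuous.tendsto y).comp hLu
    have h2 : Tendsto (fun n => j (L (u n))) atTop (𝓝 (B x)) := by
      have : (fun n => j (L (u n))) = fun n => B (u n) := funext fun n => hg (u n)
      rw [this]
      exact (B.continuous.tendsto x).comp hu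
    exact (tendsto_nhds_unique h1 h2).trans (hg x).symm
  exact ⟨⟨L, hL⟩, hg⟩

/-- If an affine family takes values in a subspace at almost every parameter, its coefficients lie
in the subspace: the parameters where it does form an affine subspace of full measure. -/
theorem coeff_mem_of_ae_affineFamily_mem {N : ℕ} {Z : Type*} [NormedAddCommGroup Z]
    [NormedSpace ℝ Z] (R : Submodule ℝ Z) (z₀ : Z) (z : Fin N → Z)
    (h : ∀ᵐ t ∂(volume.restrict (paramCube N)), affineFamily z₀ z t ∈ R) :
    z₀ ∈ R ∧ ∀ i, z i ∈ R := by
  have hcomb : ∀ (c : ℝ) (s t r : E N), affineFamily z₀ z (c • (s - t) + r) =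
      c • (affineFamily z₀ z s - affineFamily z₀ z t) + affineFamily z₀ z r := by
    intro c s t r
    simp only [affineFamily]
    rw [add_sub_add_left_eq_sub, ← Finset.sum_sub_distrib, Finset.smul_sum, add_left_comm,
      ← Finset.sum_add_distrib]
    congr 1
    refine Finset.sum_congr rfl fun i _ => ?_
    simp only [PiLp.add_apply, PiLp.smul_apply, PiLp.sub_apply, smul_eq_mul]
    module
  let S : AffineSubspace ℝ (E N) :=
    { carrier := {t | affineFamily z₀ z t ∈ R}
      smul_vsub_vadd_mem' := fun c s t r hs ht hr => by
        simp only [mem_ofPred_eq, vsub_eq_sub, vadd_eq_add] at hs ht hr ⊢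
        rw [hcomb]
        exact R.add_mem (R.smul_mem c (R.sub_mem hs ht)) hr }
  have hS : S = ⊤ := by
    by_contra hne
    have h0 := Measure.addHaar_affineSubspace volume S hne
    have h1 : ∀ᵐ t : E N, t ∉ (S : Set (E N)) := measure_eq_zero_iff_ae_notMem.1 h0
    have h2 : ∀ᵐ t ∂(volume.restrict (paramCube N)), False := by
      filter_upwards [h, ae_restrict_of_ae h1] with t a b
      exact b a
    have h3 : volume (paramCube N) = 0 := by simpa using h2
    have h4 := measure_mono_null interior_subset h3
    exact interior_paramCube_nonempty.ne_empty
      ((isOpen_interior.measure_eq_zero_iff volume).1 h4)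
  have hall : ∀ t, affineFamily z₀ z t ∈ R := fun t => by
    have : t ∈ S := hS ▸ AffineSubspace.mem_top ℝ (E N) t
    exact this
  have hz : z₀ ∈ R := by simpa using hall 0
  refine ⟨hz, fun i => ?_⟩
  have := hall (EuclideanSpace.single i 1)
  rw [affineFamily_single] at this
  exact (R.add_mem_iff_right hz).1 this

section Higher

variable {d N : ℕ} {Ω : Set (E d)} {H : Type*} [NormedAddCommGroup H] [InnerProductSpace ℝ H]
  [CompleteSpace H] {J : H →L[ℝ] L2 Ω} {D : H →L[ℝ] L2Vec Ω}
  {μ₀ : E d → ℝ} {μ : Fin N → E d → ℝ} {μmin : ℝ}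

/-- Parametric regularity in the energy space `H`. -/
theorem exists_normWInf_le_energy (hJD : ∀ w, ‖w‖ ^ 2 = ‖J w‖ ^ 2 + ‖D w‖ ^ 2)
    (hμ₀ : MemLp μ₀ ∞ (volume.restrict Ω)) (hμ : ∀ i, MemLp (μ i) ∞ (volume.restrict Ω))
    (hμmin : 0 < μmin) (hbd : ∀ᵐ p ∂((volume.restrict Ω).prod (volume.restrict (paramCube N))),
      μmin ≤ potential μ₀ μ p.1 p.2) (k : ℕ) :
    ∃ C : ℝ≥0, ∀ (f₀ : StrongDual ℝ H) (f : Fin N → StrongDual ℝ H)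
      (u : Lp H 2 (volume.restrict (paramCube N))),
      IsVarSolution J D (potential μ₀ μ) (affineFamily f₀ f) u →
        MemWInf (paramCube N) k u ∧
        normWInf (paramCube N) k u ≤ C * normWInf (paramCube N) k (affineFamily f₀ f) := by
  have hbij := fun t (ht : t ∈ paramCube N) => paramOp_bijective hμ₀ hμ hJD hμmin hbd ht
  obtain ⟨C, hC⟩ := exists_normWInf_solution_le (negLaplacian D + potOp J hμ₀)
    (fun i => potOp J (hμ i)) hbij (ContinuousLinearMap.id ℝ H) k
  refine ⟨C, fun f₀ f u hu => hC f₀ f _ u (EventuallyEq.refl _ _) ?_⟩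
  filter_upwards [hu.ae_paramOp_eq hJD hμ₀ hμ hμmin hbd,
    ae_restrict_mem isCompact_paramCube.measurableSet] with t h1 ht x hx
  exact (hbij t ht).1 (h1.trans hx.symm)

/-- Parametric regularity with values in a space `X` of more regular functions, for data in a space
`Y`, both continuously embedded in `L²(Ω)`.  The product hypothesis turns `A(t) A(0)⁻¹` into an
affine family of operators on `Y`, and the shift hypothesis makes it invertible. -/
theorem exists_normWInf_le_of_shift {X Y : Type*} [NormedAddCommGroup X] [NormedSpace ℝ X]
    [CompleteSpace X] [NormedAddCommGroup Y] [NormedSpace ℝ Y] [CompleteSpace Y]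
    (jX : X →L[ℝ] L2 Ω) (hjX : Function.Injective jX)
    (jY : Y →L[ℝ] L2 Ω) (hjY : Function.Injective jY) (hJ : Function.Injective (dualEmb J))
    (hJD : ∀ w, ‖w‖ ^ 2 = ‖J w‖ ^ 2 + ‖D w‖ ^ 2)
    (hμ₀ : MemLp μ₀ ∞ (volume.restrict Ω)) (hμ : ∀ i, MemLp (μ i) ∞ (volume.restrict Ω))
    (hμmin : 0 < μmin) (hbd : ∀ᵐ p ∂((volume.restrict Ω).prod (volume.restrict (paramCube N))),
      μmin ≤ potential μ₀ μ p.1 p.2)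
    (hmul : ∀ (i : Fin N) (v : X), ∃ w : Y, jY w = mulL2 (hμ i) (jX v))
    (hshift : ∀ t ∈ paramCube N, ∀ (g : Y) (w : H),
      paramOp J D hμ₀ hμ t w = dualEmb J (jY g) → ∃ w' : X, jX w' = J w) (k : ℕ) :
    ∃ C : ℝ≥0, ∀ (f₀ : StrongDual ℝ H) (f : Fin N → StrongDual ℝ H) (F : E N → Y)
      (u : Lp H 2 (volume.restrict (paramCube N))),
      (∀ᵐ t ∂(volume.restrict (paramCube N)), affineFamily f₀ f t = dualEmb J (jY (F t))) →
      IsVarSolution J D (potential μ₀ μ) (affineFamily f₀ f) u →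
        ∃ U : E N → X,
          (∀ᵐ t ∂(volume.restrict (paramCube N)), jX (U t) = J (u t)) ∧
          MemWInf (paramCube N) k U ∧
          normWInf (paramCube N) k U ≤ C * normWInf (paramCube N) k F := by
  have hbij := fun t (ht : t ∈ paramCube N) => paramOp_bijective hμ₀ hμ hJD hμmin hbd ht
  have hsolve : ∀ t ∈ paramCube N, ∀ G, ∃ w, paramOp J D hμ₀ hμ t w = G :=
    fun t ht => (hbij t ht).2
  have hsplit : ∀ t w, paramOp J D hμ₀ hμ t w =
      paramOp J D hμ₀ hμ 0 w + ∑ i, t i • potOp J (hμ i) w := by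
    intro t w
    simp [paramOp, affineFamily]
  have hembinj : Function.Injective fun g => dualEmb J (jY g) := hJ.comp hjY
  -- `R` is the inverse of `A(0)`, and `T` its action from `Y` to `X`.
  obtain ⟨S, -, hS⟩ := exists_contDiff_inverse (N := N) (negLaplacian D + potOp J hμ₀)
    (fun i => potOp J (hμ i)) hbij
  obtain ⟨R, hR⟩ : ∃ R : StrongDual ℝ H →L[ℝ] H, ∀ G, paramOp J D hμ₀ hμ 0 (R G) = G :=
    ⟨S 0, (hS 0 zero_mem_paramCube).2⟩
  obtain ⟨T, hT⟩ := exists_clm_comp_eq jX hjX (J.comp (R.comp ((dualEmb J).comp jY)))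
    (fun g => hshift 0 zero_mem_paramCube g (R (dualEmb J (jY g))) (hR _))
  have hT' : ∀ g w, paramOp J D hμ₀ hμ 0 w = dualEmb J (jY g) → jX (T g) = J w := by
    intro g w hw
    rw [hT, ← (hbij 0 zero_mem_paramCube).1 ((hR (dualEmb J (jY g))).trans hw.symm)]
    rfl
  have hM : ∀ i, ∃ M : X →L[ℝ] Y, ∀ v, jY (M v) = mulL2 (hμ i) (jX v) := fun i =>
    exists_clm_comp_eq jY hjY ((mulL2 (hμ i)).comp jX) (hmul i)
  choose M hM using hM
  -- `K t = A(t) A(0)⁻¹` on `Y`.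
  let K : E N → Y →L[ℝ] Y :=
    affineFamily (ContinuousLinearMap.id ℝ Y) (fun i => (M i).comp T)
  have hKapp : ∀ t g, K t g = g + ∑ i, t i • M i (T g) := by
    intro t g
    simp [K, affineFamily]
  have hsum : ∀ (t : E N) (v : X) (w : H), jX v = J w →
      dualEmb J (jY (∑ i, t i • M i v)) = ∑ i, t i • potOp J (hμ i) w := by
    intro t v w hvw
    simp only [map_sum, map_smul, hM, hvw]
    rfl
  have hKA : ∀ t g w, paramOp J D hμ₀ hμ 0 w = dualEmb J (jY g) →
      paramOp J D hμ₀ hμ t w = dualEmb J (jY (K t g)) := by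
    intro t g w hw
    rw [hsplit, hw, hKapp, map_add, map_add, hsum t (T g) w (hT' g w hw)]
  -- Injectivity is that of `A(t)`; a preimage of `g` is `A(0) w` with `A(t) w = g`, and lies in `Y`
  -- because `w` lies in `X`.
  have hKbij : ∀ t ∈ paramCube N, Function.Bijective (K t) := by
    intro t ht
    constructor
    · rw [injective_iff_map_eq_zero]
      intro g hg
      obtain ⟨w, hw⟩ := hsolve 0 zero_mem_paramCube (dualEmb J (jY g))
      have h1 := hKA t g w hw
      rw [hg, map_zero, map_zero] at h1
      have h2 : w = 0 := (hbij t ht).1 (h1.trans (map_zero _).symm)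
      rw [h2, map_zero] at hw
      exact hembinj (by simpa using hw.symm)
    · intro g
      obtain ⟨w, hw⟩ := hsolve t ht (dualEmb J (jY g))
      obtain ⟨w', hw'⟩ := hshift t ht g w hw
      have h0 : paramOp J D hμ₀ hμ 0 w = dualEmb J (jY (g - ∑ i, t i • M i w')) := by
        rw [map_sub, map_sub, hsum t w' w hw', ← hw, hsplit t w, add_sub_cancel_right]
      refine ⟨g - ∑ i, t i • M i w', hembinj ?_⟩
      exact ((hKA t _ w h0).symm.trans hw)
  obtain ⟨C, hC⟩ := exists_normWInf_solution_le (ContinuousLinearMap.id ℝ Y)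
    (fun i => (M i).comp T) hKbij T k
  obtain ⟨SK, -, hSK⟩ := exists_contDiff_inverse (ContinuousLinearMap.id ℝ Y)
    (fun i => (M i).comp T) hKbij
  refine ⟨C, fun f₀ f F u hF hu => ?_⟩
  -- The data `F` agree almost everywhere with an affine family in `Y`.
  obtain ⟨⟨y₀, hy₀⟩, hy⟩ := coeff_mem_of_ae_affineFamily_mem
    (LinearMap.range ((dualEmb J).comp jY).toLinearMap) f₀ f (by
      filter_upwards [hF] with t ht
      exact ⟨F t, ht.symm⟩)
  choose y hy using hy
  have hfy : ∀ t, affineFamily f₀ f t = dualEmb J (jY (affineFamily y₀ y t)) := by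
    intro t
    have h1 : f₀ = (dualEmb J).comp jY y₀ := hy₀.symm
    have h2 : f = fun i => (dualEmb J).comp jY (y i) := funext fun i => (hy i).symm
    rw [h1, h2, ← map_affineFamily]
    rfl
  have hFy : F =ᵐ[volume.restrict (paramCube N)] affineFamily y₀ y := by
    filter_upwards [hF] with t ht
    exact hembinj (ht.symm.trans (hfy t))
  refine ⟨fun t => T (SK t (affineFamily y₀ y t)), ?_, hC y₀ y F _ hFy ?_⟩
  · filter_upwards [hu.ae_paramOp_eq hJD hμ₀ hμ hμmin hbd,
      ae_restrict_mem isCompact_paramCube.measurableSet] with t h1 ht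
    obtain ⟨w, hw⟩ := hsolve 0 zero_mem_paramCube
      (dualEmb J (jY (SK t (affineFamily y₀ y t))))
    have h2 := hKA t _ w hw
    have h3 : K t (SK t (affineFamily y₀ y t)) = affineFamily y₀ y t := (hSK t ht).2 _
    rw [h3, ← hfy t] at h2
    have h4 : u t = w := (hbij t ht).1 (h1.trans h2.symm)
    rw [h4]
    exact hT' _ w hw
  · filter_upwards [ae_restrict_mem isCompact_paramCube.measurableSet] with t ht x hx
    rw [← hx, (hSK t ht).1]

end Higher

/-! ### The Sobolev spaces of the spatial domain -/

section Spatial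

variable {d : ℕ} {Ω : Set (E d)}

variable (Ω) in
/-- The embedding `H^m(Ω) → L²(Ω)` as a bounded operator. -/
def Hm.toL2CLM (m : ℕ) : Hm Ω m →L[ℝ] L2 Ω :=
  (PiLp.proj 2 (fun _ : MultiIndex d m => L2 Ω) 0).comp (sobolevH Ω m).subtypeL

theorem Hm.toL2CLM_injective (hΩ : IsOpen Ω) (m : ℕ) : Function.Injective (Hm.toL2CLM Ω m) := by
  intro v w h
  have h0 : v.1 0 = w.1 0 := h
  refine Subtype.ext (PiLp.ext fun α => ?_)
  have hv : IsWeakDeriv Ω α.1 (v.1 0) (v.1 α) := v.2 α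
  have hw : IsWeakDeriv Ω α.1 (w.1 0) (w.1 α) := w.2 α
  rw [h0] at hv
  exact Lp.ext (ae_restrict_of_ae_interior hΩ (hv.ae_eq hw))

theorem Hm.memW {m : ℕ} (v : Hm Ω m) : MemW 2 Ω m v.toL2 :=
  fun α => ⟨v.1 α, v.2 α, Lp.memLp _⟩

/-- A square integrable function of class `W^{m,2}` is the function of an element of `H^m`. -/
theorem MemW.exists_Hm (hΩ : IsOpen Ω) {m : ℕ} {u : L2 Ω} (hu : MemW 2 Ω m u) :
    ∃ v : Hm Ω m, v.toL2 = u := by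
  choose g hg hg2 using hu
  let v : PiLp 2 (fun _ : MultiIndex d m => L2 Ω) := WithLp.toLp 2 fun α => (hg2 α).toLp (g α)
  have hv : ∀ α, v α =ᵐ[volume.restrict Ω] g α := fun α => (hg2 α).coeFn_toLp
  have h0 : g 0 =ᵐ[volume.restrict Ω] u :=
    ae_restrict_of_ae_interior hΩ ((hg 0).ae_eq (IsWeakDeriv.zero (hg 0).locInt))
  have hv0 : v 0 = u := Lp.ext ((hv 0).trans h0)
  refine ⟨⟨v, fun α => ?_⟩, hv0⟩
  rw [hv0]
  exact (hg α).congr (EventuallyEq.refl _ _) (hv α).symm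

theorem exists_Hm_eq_mulL2 (hΩ : IsOpen Ω) {m l : ℕ} (hl : l ≤ m) {a : E d → ℝ}
    (ha : MemLp a ∞ (volume.restrict Ω)) (haW : MemWInf Ω l a) (v : Hm Ω m) :
    ∃ w : Hm Ω l, w.toL2 = mulL2 ha v.toL2 := by
  refine MemW.exists_Hm hΩ fun α => ?_
  obtain ⟨g, hg, hg2⟩ := MemW.mul (p := 2) hΩ (by norm_num) haW (v.memW.mono hl) α
  exact ⟨g, hg.congr (coeFn_mulL2 ha v.toL2).symm (EventuallyEq.refl _ _), hg2⟩

/-- The embedding `L²(Ω) → H⁻¹(Ω)` is injective, since `H¹₀(Ω)` contains the test functions. -/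
theorem dualEmb_toL2_injective (hΩ : IsOpen Ω) :
    Function.Injective (dualEmb (H10.toL2 Ω)) := by
  rw [injective_iff_map_eq_zero]
  intro g hg
  have h0 : ∀ v : H10 Ω, ⟪g, H10.toL2 Ω v⟫ = 0 := fun v => DFunLike.congr_fun hg v
  have hint : ∀ φ : E d → ℝ, IsTest Ω φ → ∫ x in Ω, φ x • g x = 0 := by
    intro φ hφ
    have hgrad : Continuous (gradient φ) := by
      unfold gradient
      exact (InnerProductSpace.toDual ℝ (E d)).symm.continuous.comp
        (hφ.smooth.continuous_fderiv (by simp))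
    have hgc : HasCompactSupport (gradient φ) :=
      (hφ.compact.fderiv ℝ).comp_left (map_zero (InnerProductSpace.toDual ℝ (E d)).symm)
    have hg2 : MemLp (gradient φ) 2 (volume.restrict Ω) :=
      (hgrad.memLp_of_hasCompactSupport hgc).restrict Ω
    let p : WithLp 2 (L2 Ω × L2Vec Ω) := WithLp.toLp 2 (hφ.memLp.toLp φ, hg2.toLp (gradient φ))
    have hp : p ∈ testGraph Ω := ⟨φ, hφ, hφ.memLp.coeFn_toLp, hg2.coeFn_toLp⟩
    have h1 : ⟪g, hφ.memLp.toLp φ⟫ = 0 :=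
      h0 ⟨p, (testGraph Ω).le_topologicalClosure hp⟩
    rw [← h1, L2.inner_def]
    refine integral_congr_ae ?_
    filter_upwards [hφ.memLp.coeFn_toLp] with x hx
    rw [hx]
    simp
  have hz := ae_eq_of_forall_integral_smul_eq (Ω := Ω) (u := g) (v := fun _ => (0 : ℝ))
    g.locallyIntegrableOn (by
      exact (locallyIntegrable_const 0).locallyIntegrableOn _)
    (fun φ hφ => by simpa using hint φ hφ)
  refine Lp.ext ((ae_restrict_of_ae_interior hΩ hz).trans ?_)
  exact (Lp.coeFn_zero ℝ 2 (volume.restrict Ω)).symm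

theorem H10.norm_sq_eq (w : H10 Ω) : ‖w‖ ^ 2 = ‖H10.toL2 Ω w‖ ^ 2 + ‖H10.grad Ω w‖ ^ 2 :=
  WithLp.prod_norm_sq_eq_of_L2 (w : WithLp 2 (L2 Ω × L2Vec Ω))

end Spatial

theorem isOpen_of_domain {d : ℕ} {Ω : Set (E d)} (hΩ : IsConvexPolytopeDomain Ω ∨ IsC11Domain Ω) :
    IsOpen Ω := by
  rcases hΩ with ⟨-, s, rfl⟩ | h
  · exact isOpen_interior
  · exact h.isOpen

end ParamElliptic

end

theorem mainTheorem4 {d N : ℕ} (hd : d = 2 ∨ d = 3) (hN : 1 ≤ N)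
    (Ω : Set (E d)) (hΩ : IsConvexPolytopeDomain Ω ∨ IsC11Domain Ω)
    (μ₀ : E d → ℝ) (μ : Fin N → E d → ℝ)
    (hμ₀ : MemLp μ₀ ∞ (volume.restrict Ω)) (hμ : ∀ i, MemLp (μ i) ∞ (volume.restrict Ω))
    (μmin μmax : ℝ) (hμmin : 0 < μmin) (hμmax : μmin ≤ μmax)
    (hbd : ∀ᵐ p ∂((volume.restrict Ω).prod (volume.restrict (paramCube N))),
      μmin ≤ potential μ₀ μ p.1 p.2 ∧ potential μ₀ μ p.1 p.2 ≤ μmax) :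
    -- existence and uniqueness in `W`
    (∀ (f₀ : HNeg1 Ω) (f : Fin N → HNeg1 Ω),
      ∃! u : W N Ω, IsWeakSolution (potential μ₀ μ) (source f₀ f) u) ∧
    -- parametric regularity in the energy space
    (∀ k : ℕ, ∃ C : ℝ≥0, ∀ (f₀ : HNeg1 Ω) (f : Fin N → HNeg1 Ω) (u : W N Ω),
      IsWeakSolution (potential μ₀ μ) (source f₀ f) u →
        MemWInf (paramCube N) k u ∧
        normWInf (paramCube N) k u ≤ C * normWInf (paramCube N) k (source f₀ f)) ∧
    -- parametric regularity with values in `H^m(Ω)`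
    (∀ m : ℕ, 2 ≤ m → MemWInf Ω (m - 2) μ₀ → (∀ i, MemWInf Ω (m - 2) (μ i)) →
      UniformShift Ω (potential μ₀ μ) m →
      ∀ k : ℕ, ∃ C : ℝ≥0, ∀ (f₀ : HNeg1 Ω) (f : Fin N → HNeg1 Ω) (F : E N → Hm Ω (m - 2))
        (u : W N Ω),
        MemWInf (paramCube N) k F →
        (∀ᵐ t ∂(volume.restrict (paramCube N)), source f₀ f t = L2.toHNeg1 (F t).toL2) →
        IsWeakSolution (potential μ₀ μ) (source f₀ f) u →
          ∃ U : E N → Hm Ω m,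
            (∀ᵐ t ∂(volume.restrict (paramCube N)), (U t).toL2 = H10.toL2 Ω (u t)) ∧
            MemWInf (paramCube N) k U ∧
            normWInf (paramCube N) k U ≤ C * normWInf (paramCube N) k F) := by 
  have hΩo : IsOpen Ω := isOpen_of_domain hΩ
  have hlow : ∀ᵐ p ∂((volume.restrict Ω).prod (volume.restrict (paramCube N))),
      μmin ≤ potential μ₀ μ p.1 p.2 := hbd.mono fun p hp => hp.1
  have hJD := H10.norm_sq_eq (Ω := Ω)
  refine ⟨fun f₀ f => ?_, fun k => ?_, fun m hm hW₀ hW hshift k => ?_⟩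
  · obtain ⟨u, hu⟩ := exists_ae_paramOp_eq hμ₀ hμ hJD hμmin hlow f₀ f
    have hsol := isVarSolution_of_ae hμ₀ hμ hu
    exact ⟨u, hsol, fun u' hu' => IsVarSolution.unique hJD hμ₀ hμ hμmin hlow hu' hsol⟩
  · exact exists_normWInf_le_energy hJD hμ₀ hμ hμmin hlow k
  · obtain ⟨C₀, hC₀⟩ := hshift
    obtain ⟨C, hC⟩ := exists_normWInf_le_of_shift (Hm.toL2CLM Ω m) (Hm.toL2CLM_injective hΩo m)
      (Hm.toL2CLM Ω (m - 2)) (Hm.toL2CLM_injective hΩo (m - 2)) (dualEmb_toL2_injective hΩo)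
      hJD hμ₀ hμ hμmin hlow (fun i v => exists_Hm_eq_mulL2 hΩo (Nat.sub_le m 2) (hμ i) (hW i) v)
      (fun t ht g w hw => by
        obtain ⟨w', hw', -⟩ := hC₀ t ht g w ((paramOp_eq_iff hμ₀ hμ t _ w).1 hw)
        exact ⟨w', hw'⟩) k
    exact ⟨C, fun f₀ f F u _ hF hu => hC f₀ f F u hF hu⟩
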